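/- **Setting.** Let $(X,\mathcal A,m)$ be a probability space (for instance a Lebesgue space) and let $f:X\to X$ be a bimeasurable bijection that preserves $m$ and is ergodic. Let $\pi:X\to\overline X$ be a measurable map to a measurable space $(\overline X,\overline{\mathcal A})$ and let $\overline f:\overline X\to\overline X$ be a measurable map (not necessarily invertible) with $\pi\circ f=\overline f\circ\pi$; put $\overline m=\pi_*m$. (Then $\mathcal B=\pi^{-1}\overline{\mathcal A}$ is a sub-$\sigma$-algebra with $f^{-1}\mathcal B\subset\mathcal B$, and $\overline X$ is the quotient space associated with it.) Let $\overline\Pi:\overline{\mathcal E}\to\overline X$ be a measurable fiber bundle whose fibers $\overline{\mathcal E}_{\overline x}$ are compact Riemannian manifolds (without boundary, metrics of class $C^2$) of bounded dimensions and diameters. That is, there are a countable measurable partition $(U_i)$ of $\overline X$, compact smooth manifolds $N_i$ and diffeomorphisms $\overline{\mathcal E}_{\overline x}\to N_i$, $\overline x\in U_i$, which identify $\overline\Pi^{-1}(U_i)$ with $U_i\times N_i$ as a measurable space and carry the metrics of the fibers to metrics on $N_i$ that depend measurably on $\overline x$. Let $d$ be the maximal dimension of the fibers. Assume that the $C^2$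 norms of the metrics are uniformly bounded: there are $r>0$ and $C$ such that every point of every fiber is the center of a smooth chart whose image contains the Euclidean ball $B(0,r)$ and in which, on this ball, the metric is bounded below by $C^{-1}$ times the Euclidean one and its coefficients and their derivatives of order at most $2$ are bounded by $C$. Let $\overline F:\overline{\mathcal E}\to\overline{\mathcal E}$ be a measurable bundle of $C^2$-diffeomorphisms $\overline F_{\overline x}:\overline{\mathcal E}_{\overline x}\to\overline{\mathcal E}_{\overline f\overline x}$ such that $\|D_\xi\overline F_{\overline x}\|$, $\|(D_\xi\overline F_{\overline x})^{-1}\|$ and the second derivatives of $\overline F_{\overline x}$ in the above charts are uniformly bounded. Let $\mathcal E=\{(x,\xi):x\in X,\ \xi\in\overline{\mathcal E}_{\pi x}\}$ be the pullback bundle over $X$, with projections $\Pi:\mathcal E\to X$ and $\overline\pi:\mathcal E\to\overline{\mathcal E}$, $\overline\pi(x,\xi)=(\pi x,\xi)$, and put $F(x,\xi)=(fx,F_x\xi)$ with $F_x=\overline F_{\pi x}$, and $F_x^{(n)}=F_{f^{n-1}x}\circ\cdots\circ F_x$. Let $M$ be an ergodic $F$-invariant probability measure on $\mathcal E$ with $\Pi_*M=m$,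 and let $\gamma^-$ be the number such that, for $M$-a.e. $(x,\xi)$, $$\gamma^-=-\lim_{n\to\infty}\frac1n\log\|(D_\xi F_x^{(n)})^{-1}\| .$$ Let $\overline M=\overline\pi_*M$, let $\overline M=\int\overline M_{\overline x}\,d\overline m(\overline x)$ be a disintegration of $\overline M$ into probability measures $\overline M_{\overline x}$ on the fibers $\overline{\mathcal E}_{\overline x}$, and define the fiber entropy $$\kappa=\int\left(\int\log\frac{d(\overline F_{\overline x})_*\overline M_{\overline x}}{d\overline M_{\overline f\overline x}}(\overline F_{\overline x}\xi)\,d\overline M_{\overline x}(\xi)\right)d\overline m(\overline x)\in[0,+\infty],$$ where the inner integral, the Kullback–Leibler divergence of $(\overline F_{\overline x})_*\overline M_{\overline x}$ from $\overline M_{\overline f\overline x}$, is $+\infty$ when $(\overline F_{\overline x})_*\overline M_{\overline x}$ is not absolutely continuous with respect to $\overline M_{\overline f\overline x}$ or when the logarithm is not integrable. **Proposition (basic inequality for the fiber entropy).** $$\kappa\le -d\,\min\{\gamma^-,0\}.$$ -/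

import Mathlib

open MeasureTheory Filter Topology Bundle Manifold
open scoped ContDiff ENNReal

universe u v

/-- A measurable fiber bundle over `B` whose fibers are compact Riemannian manifolds without
boundary (of dimension `dim y` over `y`, with a `C^2` metric whose geodesic distance is finite).

The bundle is measurably locally trivial: there are countably many compact smooth manifolds
`Model i`, the sets `{y | idx y = i}` form a countable measurable partition of `B`, and over such a
set each fiber is identified with `Model i` by the diffeomorphism `triv i y`. The Riemannian metrics
of the fibers, transported to `Model i`, depend measurably on the base point. -/
structure RiemannianFiberBundle (B : Type u) [MeasurableSpace B] where
  Fib : B → Type v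
  dim : B → ℕ
  [metricSpace : ∀ y, MetricSpace (Fib y)]
  [compactSpace : ∀ y, CompactSpace (Fib y)]
  [chartedSpace : ∀ y, ChartedSpace (EuclideanSpace ℝ (Fin (dim y))) (Fib y)]
  [isManifold : ∀ y, IsManifold (𝓡 (dim y)) ∞ (Fib y)]
  [riemannianBundle : ∀ y, RiemannianBundle (fun ξ : Fib y => TangentSpace (𝓡 (dim y)) ξ)]
  [contMDiffMetric : ∀ y, IsContMDiffRiemannianBundle (𝓡 (dim y)) 2
    (EuclideanSpace ℝ (Fin (dim y))) (fun ξ : Fib y => TangentSpace (𝓡 (dim y)) ξ)]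
  [isRiemannianManifold : ∀ y, IsRiemannianManifold (𝓡 (dim y)) (Fib y)]
  Model : ℕ → Type v
  modelDim : ℕ → ℕ
  [modelTop : ∀ i, TopologicalSpace (Model i)]
  [modelT2 : ∀ i, T2Space (Model i)]
  [modelCompact : ∀ i, CompactSpace (Model i)]
  [modelCharted : ∀ i, ChartedSpace (EuclideanSpace ℝ (Fin (modelDim i))) (Model i)]
  [modelManifold : ∀ i, IsManifold (𝓡 (modelDim i)) ∞ (Model i)]
  idx : B → ℕ
  measurable_idx : Measurable idx
  triv : ∀ (i : ℕ) (y : B), idx y = i →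
    Diffeomorph (𝓡 (dim y)) (𝓡 (modelDim i)) (Fib y) (Model i) ∞
  measurable_metric : ∀ (i : ℕ) (η : Model i) (w : TangentSpace (𝓡 (modelDim i)) η),
    Measurable (fun y : {y : B // idx y = i} =>
      ‖mfderiv (𝓡 (modelDim i)) (𝓡 (dim y.1)) (triv i y.1 y.2).symm η w‖)

namespace RiemannianFiberBundle

variable {B : Type u} [MeasurableSpace B]

attribute [instance] metricSpace compactSpace chartedSpace isManifold riemannianBundle
  contMDiffMetric isRiemannianManifold modelTop modelT2 modelCompact modelCharted modelManifold

instance instMeasurableSpaceFib (E : RiemannianFiberBundle.{u, v} B) (y : B) :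
    MeasurableSpace (E.Fib y) := borel _

instance instBorelSpaceFib (E : RiemannianFiberBundle.{u, v} B) (y : B) :
    BorelSpace (E.Fib y) := ⟨rfl⟩

instance instMeasurableSpaceModel (E : RiemannianFiberBundle.{u, v} B) (i : ℕ) :
    MeasurableSpace (E.Model i) := borel _

instance instBorelSpaceModel (E : RiemannianFiberBundle.{u, v} B) (i : ℕ) :
    BorelSpace (E.Model i) := ⟨rfl⟩

/-- The total space: pairs of a base point and a point of the fiber over it. -/
structure Total (E : RiemannianFiberBundle.{u, v} B) where
  base : B
  pt : E.Fib base

/-- The trivialization of the total space as a subset of `B × ⨆ i, Model i`. -/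
noncomputable def Total.trivMap {E : RiemannianFiberBundle.{u, v} B} (p : E.Total) : B × (Σ i, E.Model i) :=
  (p.base, ⟨E.idx p.base, E.triv (E.idx p.base) p.base rfl p.pt⟩)

/-- Over `{y | idx y = i}` this is the product `σ`-algebra of `B` and the Borel sets of
`Model i`. -/
noncomputable instance instMeasurableSpaceTotal (E : RiemannianFiberBundle.{u, v} B) :
    MeasurableSpace E.Total := MeasurableSpace.comap Total.trivMap inferInstance

/-- The pullback of the bundle `E` over `B` by a map `q : X → B`: its fiber over `x` is the fiber of
`E` over `q x`. -/
def Pullback {X : Type*} (E : RiemannianFiberBundle.{u, v} B) (q : X → B) : Type _ :=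
  {p : X × E.Total // p.2.base = q p.1}

noncomputable instance instMeasurableSpacePullback {X : Type*} [MeasurableSpace X]
    (E : RiemannianFiberBundle.{u, v} B) (q : X → B) : MeasurableSpace (E.Pullback q) :=
  inferInstanceAs (MeasurableSpace {p : X × E.Total // p.2.base = q p.1})

/-- The projection of the pullback to its base `X`. -/
def Pullback.proj {X : Type*} {E : RiemannianFiberBundle.{u, v} B} {q : X → B}
    (p : E.Pullback q) : X := p.1.1

/-- The fibered projection of the pullback to the bundle `E`. -/
def Pullback.toTotal {X : Type*} {E : RiemannianFiberBundle.{u, v} B} {q : X → B}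
    (p : E.Pullback q) : E.Total := p.1.2

/-- The Gram form `(v, w) ↦ g(∂_v, ∂_w)` at the point `u` of the Riemannian metric of the fiber over
`y`, read in the chart `φ`. -/
noncomputable def gram (E : RiemannianFiberBundle.{u, v} B) (y : B)
    (φ : OpenPartialHomeomorph (E.Fib y) (EuclideanSpace ℝ (Fin (E.dim y))))
    (u v w : EuclideanSpace ℝ (Fin (E.dim y))) : ℝ :=
  inner ℝ (mfderiv (𝓡 (E.dim y)) (𝓡 (E.dim y)) φ.symm u v)
    (mfderiv (𝓡 (E.dim y)) (𝓡 (E.dim y)) φ.symm u w)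

/-- Reference charts for the statement that the `C^2` norms of the metrics of the fibers are
uniformly bounded: around every point of every fiber there is a chart that covers the Euclidean ball
of radius `r`, in which the metric is bounded below by `C⁻¹` and its coefficients are bounded
by `C`, together with their derivatives of order `1` and `2`. -/
structure ReferenceCharts (E : RiemannianFiberBundle.{u, v} B) where
  r : ℝ
  C : ℝ
  r_pos : 0 < r
  chart : ∀ (y : B) (_ : E.Fib y),
    OpenPartialHomeomorph (E.Fib y) (EuclideanSpace ℝ (Fin (E.dim y)))
  mem_atlas : ∀ y ξ, chart y ξ ∈ IsManifold.maximalAtlas (𝓡 (E.dim y)) ∞ (E.Fib y)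
  mem_source : ∀ y ξ, ξ ∈ (chart y ξ).source
  map_center : ∀ y ξ, chart y ξ ξ = 0
  ball_subset : ∀ y ξ, Metric.ball 0 r ⊆ (chart y ξ).target
  lower_bound : ∀ y ξ, ∀ u ∈ Metric.ball (0 : EuclideanSpace ℝ (Fin (E.dim y))) r, ∀ v,
    ‖v‖ ^ 2 ≤ C * E.gram y (chart y ξ) u v v
  upper_bound : ∀ y ξ, ∀ k ≤ 2, ∀ u ∈ Metric.ball (0 : EuclideanSpace ℝ (Fin (E.dim y))) r,
    ∀ v w, ‖iteratedFDeriv ℝ k (fun z => E.gram y (chart y ξ) z v w) u‖ ≤ C * ‖v‖ * ‖w‖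

/-- A measurable bundle of `C^2`-diffeomorphisms `F_y : E_y → E_{g y}` over the map `g`. -/
structure DiffeoBundle (E : RiemannianFiberBundle.{u, v} B) (g : B → B) where
  map : ∀ y, Diffeomorph (𝓡 (E.dim y)) (𝓡 (E.dim (g y))) (E.Fib y) (E.Fib (g y)) 2
  measurable_map :
    Measurable (fun p : E.Total => (⟨g p.base, map p.base p.pt⟩ : E.Total))

namespace DiffeoBundle

variable {E : RiemannianFiberBundle.{u, v} B} {g : B → B}

/-- The map `(y, ξ) ↦ (g y, F_y ξ)` of the total space. -/
noncomputable def total (F : E.DiffeoBundle g) (p : E.Total) : E.Total := ⟨g p.base, F.map p.base p.pt⟩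

/-- `F^(n)_y = F_{g^{n-1} y} ∘ … ∘ F_y`. -/
noncomputable def iter (F : E.DiffeoBundle g) : ∀ (n : ℕ) (y : B),
    Diffeomorph (𝓡 (E.dim y)) (𝓡 (E.dim (g^[n] y))) (E.Fib y) (E.Fib (g^[n] y)) 2
  | 0, y => Diffeomorph.refl (𝓡 (E.dim y)) (E.Fib y) 2
  | n + 1, y => (F.map y).trans (F.iter n (g y))

/-- The differential `D_ξ F^(n)_y`, an isomorphism of tangent spaces. -/
noncomputable def deriv (F : E.DiffeoBundle g) (n : ℕ) (y : B) (ξ : E.Fib y) :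
    TangentSpace (𝓡 (E.dim y)) ξ ≃L[ℝ] TangentSpace (𝓡 (E.dim (g^[n] y))) (F.iter n y ξ) :=
  (F.iter n y).mfderivToContinuousLinearEquiv (by norm_num) ξ

/-- The operator norm `‖D_ξ F^(n)_y‖` for the Riemannian norms of the tangent spaces. -/
noncomputable def derivNorm (F : E.DiffeoBundle g) (n : ℕ) (p : E.Total) : ℝ :=
  ‖(F.deriv n p.base p.pt : TangentSpace (𝓡 (E.dim p.base)) p.pt →L[ℝ]
    TangentSpace (𝓡 (E.dim (g^[n] p.base))) (F.iter n p.base p.pt))‖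

/-- The operator norm `‖(D_ξ F^(n)_y)⁻¹‖` for the Riemannian norms of the tangent spaces. -/
noncomputable def invDerivNorm (F : E.DiffeoBundle g) (n : ℕ) (p : E.Total) : ℝ :=
  ‖((F.deriv n p.base p.pt).symm : TangentSpace (𝓡 (E.dim (g^[n] p.base)))
    (F.iter n p.base p.pt) →L[ℝ] TangentSpace (𝓡 (E.dim p.base)) p.pt)‖

/-- The first derivatives of the maps `F_y` and of their inverses, and the second derivatives of
the maps `F_y`, are bounded by `K`. The second derivatives are computed in the reference charts; as
the metrics are bounded in `C^2` there, this amounts to a bound on the covariant Hessian. -/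
def IsBounded (F : E.DiffeoBundle g) (R : E.ReferenceCharts) (K : ℝ) : Prop :=
  (∀ p : E.Total, F.derivNorm 1 p ≤ K ∧ F.invDerivNorm 1 p ≤ K) ∧
  ∀ (y : B) (ξ : E.Fib y), ∀ u ∈ Metric.ball (0 : EuclideanSpace ℝ (Fin (E.dim y))) R.r,
    F.map y ((R.chart y ξ).symm u) ∈ (R.chart (g y) (F.map y ξ)).source →
    R.chart (g y) (F.map y ξ) (F.map y ((R.chart y ξ).symm u)) ∈ Metric.ball 0 R.r →
    ‖iteratedFDeriv ℝ 2
      (fun z => R.chart (g y) (F.map y ξ) (F.map y ((R.chart y ξ).symm z))) u‖ ≤ K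

/-- The map induced by `F` on the pullback of `E` by `q`, over a map `f` with `q ∘ f = g ∘ q`:
`(x, ξ) ↦ (f x, F_{q x} ξ)`. -/
noncomputable def pullback {X : Type*} (F : E.DiffeoBundle g) {q : X → B} {f : X → X}
    (h : ∀ x, q (f x) = g (q x)) (p : E.Pullback q) : E.Pullback q :=
  ⟨(f p.proj, F.total p.toTotal), (congrArg g p.2).trans (h p.proj).symm⟩

/-- The fiber entropy `∫ (∫ log (d(F_y)_* K_y / dK_{g y}) (F_y ξ) dK_y(ξ)) dm(y)` of a family of
probability measures `K_y` on the fibers. By the change of variables `F_y`, the inner integral is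
the Kullback-Leibler divergence of `(F_y)_* K_y` from `K_{g y}`, which is `+∞` if the first measure
is not absolutely continuous or if the logarithm of the density is not integrable. -/
noncomputable def fiberEntropy (F : E.DiffeoBundle g) (m : Measure B)
    (K : ∀ y, Measure (E.Fib y)) : ℝ≥0∞ :=
  ∫⁻ y, InformationTheory.klDiv ((K y).map (F.map y)) (K (g y)) ∂m

end DiffeoBundle

/-- The family `K` of measures on the fibers is a disintegration `M = ∫ K_y dm(y)` of the measure
`M` on the total space. -/
structure IsDisintegration (E : RiemannianFiberBundle.{u, v} B) (M : Measure E.Total)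
    (m : Measure B) (K : ∀ y, Measure (E.Fib y)) : Prop where
  isProbabilityMeasure : ∀ᵐ y ∂m, IsProbabilityMeasure (K y)
  measurable : ∀ A : Set E.Total, MeasurableSet A →
    Measurable (fun y => K y {ξ | (⟨y, ξ⟩ : E.Total) ∈ A})
  lintegral_eq : ∀ A : Set E.Total, MeasurableSet A →
    M A = ∫⁻ y, K y {ξ | (⟨y, ξ⟩ : E.Total) ∈ A} ∂m

end RiemannianFiberBundle

/-!
The inequality `κ ≤ -d min (γ⁻, 0)` is obtained by coding the fiber dynamics with finitely many
labels and counting.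

Fix a time `n` and label the points of the total space measurably by a finite set, so that two
points of the same fiber with the same label are close. Let `P_j(y)` be the distribution of the
label of `F^(j)_y ξ` for a `K_y`-random `ξ`. The divergence of `P_{j+1}(y)` from `P_j(g y)` is a
cross entropy minus an entropy. By the invariance of `M`, the mean of the cross entropy is the mean
entropy of `P_j`, so the sum of the mean divergences over `j < n` telescopes to the mean entropy of
`P_0` minus that of `P_n`. This difference is at most the mean of the logarithm of the number of
labels of points `ξ'` such that `F^(n) ξ'` has the same label as `F^(n) ξ`
(`DiffeoBundle.labelCount`). When the labels become finer, the divergences of the label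
distributions bound the Kullback-Leibler divergence of the measures from below in the limit
(`klDiv_le_liminf_of_fine_labels`, by the variational formula for the divergence). Hence
`n κ ≤ liminf ∫ log labelCount` (`DiffeoBundle.mul_fiberEntropy_le_liminf`).

The labels are built from `δ`-separated nets of the fibers. To obtain measurability, the base is
partitioned into countably many measurable classes on which the metrics, read in the model manifold,
are `2`-comparable (`exists_measurable_metricClose`); the fibers of a class are compared with one
reference fiber. By a volume argument in the reference charts, a small ball, of radius `s ≥ δ`, in a
fiber meets at most a constant times `(s / δ)^d` labels (`exists_labeling`). For fixed `ξ` and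
`δ → 0`, the points whose `n`-th iterate is at distance at most `4 δ` from `F^(n) ξ` are at
distance at most a constant times `max (‖(D_ξ F^(n))⁻¹‖, 1) δ` from `ξ`, and uniformly at distance
at most `4 C^n δ`, with `C ≥ 1` a bound for the derivatives of the inverses. By the reverse Fatou
lemma, `n κ` is at most the mean of a function bounded by `d log⁺ ‖(D F^(n))⁻¹‖` plus a constant that does
not depend on `n` (`DiffeoBundle.exists_mul_fiberEntropy_le_lintegral`). Division by `n` and a
second application of the reverse Fatou lemma give the claim.
-/

open scoped NNReal

/-! ### Entropy of finite probability vectors -/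

/-- The surprisal `-log x` of a probability `x`, as an extended nonnegative number, with
`-log 0 = ∞`. -/
noncomputable def negLog (x : ℝ≥0∞) : ℝ≥0∞ :=
  if x = 0 then ⊤ else ENNReal.ofReal (-Real.log x.toReal)

theorem measurable_negLog : Measurable negLog := by
  unfold negLog
  refine Measurable.ite (measurableSet_singleton 0) measurable_const ?_
  fun_prop

/-- The cross entropy `-∑ i, p i * log (q i)`; it is the Shannon entropy of `p` when `q = p`. -/
noncomputable def crossEntropy {ι : Type*} [Fintype ι] (p q : ι → ℝ≥0∞) : ℝ≥0∞ :=
  ∑ i, p i * negLog (q i)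

section Finite

variable {ι : Type*} [Fintype ι] {p q : ι → ℝ≥0∞}

theorem le_one_of_sum_eq_one (hp : ∑ i, p i = 1) (i : ι) : p i ≤ 1 :=
  hp ▸ Finset.single_le_sum (f := p) (fun _ _ => zero_le) (Finset.mem_univ i)

theorem sum_toReal_eq_one (hp : ∑ i, p i = 1) : ∑ i, (p i).toReal = 1 := by
  rw [← ENNReal.toReal_sum (fun i _ => ((le_one_of_sum_eq_one hp i).trans_lt (by simp)).ne), hp]
  simp

theorem crossEntropy_eq_ofReal (hp : ∑ i, p i = 1) (hq : ∑ i, q i = 1)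
    (h : ∀ i, q i = 0 → p i = 0) :
    crossEntropy p q = ENNReal.ofReal (∑ i, (p i).toReal * -Real.log (q i).toReal) := by
  have hlog (i : ι) : 0 ≤ -Real.log (q i).toReal := by
    have := Real.log_nonpos (x := (q i).toReal) ENNReal.toReal_nonneg
      (ENNReal.toReal_le_of_le_ofReal zero_le_one (by simpa using le_one_of_sum_eq_one hq i))
    linarith
  rw [ENNReal.ofReal_sum_of_nonneg fun i _ => mul_nonneg ENNReal.toReal_nonneg (hlog i)]
  refine Finset.sum_congr rfl fun i _ => ?_
  have hpi : p i ≠ ⊤ := ((le_one_of_sum_eq_one hp i).trans_lt (by simp)).ne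
  by_cases hqi : q i = 0
  · simp [h i hqi]
  · rw [negLog, if_neg hqi, ENNReal.ofReal_mul ENNReal.toReal_nonneg, ENNReal.ofReal_toReal hpi]

/-- Duality for the relative entropy of finite probability vectors: every function `a` gives a lower
bound for `crossEntropy p q - crossEntropy p p`. -/
theorem ofReal_add_crossEntropy_self_le (hp : ∑ i, p i = 1) (hq : ∑ i, q i = 1) (a : ι → ℝ) :
    ENNReal.ofReal (∑ i, a i * (p i).toReal - ∑ i, (Real.exp (a i) - 1) * (q i).toReal)
      + crossEntropy p p ≤ crossEntropy p q := by
  by_cases h : ∀ i, q i = 0 → p i = 0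
  · have key (b : ι → ℝ) : (∑ i, b i * (p i).toReal - ∑ i, (Real.exp (b i) - 1) * (q i).toReal)
        + ∑ i, (p i).toReal * -Real.log (p i).toReal
        ≤ ∑ i, (p i).toReal * -Real.log (q i).toReal := by
      have h1 (i : ι) : b i * (p i).toReal - Real.exp (b i) * (q i).toReal
          + (p i).toReal * -Real.log (p i).toReal + (p i).toReal
          ≤ (p i).toReal * -Real.log (q i).toReal := by
        rcases (ENNReal.toReal_nonneg (a := p i)).eq_or_lt with h0 | h0
        · rw [← h0]
          have : 0 ≤ Real.exp (b i) * (q i).toReal := by positivity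
          simpa using this
        · have hqi : 0 < (q i).toReal := by
            refine ENNReal.toReal_pos (fun hq0 => ?_)
              ((le_one_of_sum_eq_one hq i).trans_lt (by simp)).ne
            rw [h i hq0] at h0
            simp at h0
          have := Real.log_le_sub_one_of_pos
            (x := Real.exp (b i) * (q i).toReal / (p i).toReal) (by positivity)
          rw [Real.log_div (by positivity) h0.ne', Real.log_mul (by positivity) hqi.ne',
            Real.log_exp] at this
          have h2 := mul_le_mul_of_nonneg_left this h0.le
          have h3 : (p i).toReal * (Real.exp (b i) * (q i).toReal / (p i).toReal - 1)
              = Real.exp (b i) * (q i).toReal - (p i).toReal := by field_simp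
          nlinarith
      have h2 := Finset.sum_le_sum fun i (_ : i ∈ Finset.univ) => h1 i
      simp only [Finset.sum_add_distrib, Finset.sum_sub_distrib] at h2
      simp only [sub_mul, one_mul, Finset.sum_sub_distrib]
      rw [sum_toReal_eq_one hp] at h2
      rw [sum_toReal_eq_one hq]
      linarith
    rw [crossEntropy_eq_ofReal hp hq h, crossEntropy_eq_ofReal hp hp fun _ => id]
    have hnn : 0 ≤ ∑ i, (p i).toReal * -Real.log (p i).toReal := by
      refine Finset.sum_nonneg fun i _ => mul_nonneg ENNReal.toReal_nonneg ?_
      have := Real.log_nonpos (x := (p i).toReal) ENNReal.toReal_nonneg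
        (ENNReal.toReal_le_of_le_ofReal zero_le_one (by simpa using le_one_of_sum_eq_one hp i))
      linarith
    rcases le_total 0 (∑ i, a i * (p i).toReal - ∑ i, (Real.exp (a i) - 1) * (q i).toReal)
      with h0 | h0
    · rw [← ENNReal.ofReal_add h0 hnn]
      exact ENNReal.ofReal_le_ofReal (key a)
    · rw [ENNReal.ofReal_of_nonpos h0, zero_add]
      exact ENNReal.ofReal_le_ofReal (by simpa using key 0)
  · push Not at h
    obtain ⟨i, hqi, hpi⟩ := h
    have : crossEntropy p q = ⊤ := by
      refine ENNReal.sum_eq_top.2 ⟨i, Finset.mem_univ i, ?_⟩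
      rw [hqi, negLog, if_pos rfl, ENNReal.mul_top hpi]
    rw [this]
    exact le_top

/-- Gibbs' inequality for finite probability vectors. -/
theorem crossEntropy_self_le (hp : ∑ i, p i = 1) (hq : ∑ i, q i = 1) :
    crossEntropy p p ≤ crossEntropy p q := by
  simpa using ofReal_add_crossEntropy_self_le hp hq 0

theorem mul_negLog_self_le_one {x : ℝ≥0∞} (hx : x ≤ 1) : x * negLog x ≤ 1 := by
  have hx' : x ≠ ⊤ := (hx.trans_lt (by simp)).ne
  by_cases h0 : x = 0
  · simp [h0]
  have hpos : 0 < x.toReal := ENNReal.toReal_pos h0 hx'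
  rw [negLog, if_neg h0]
  nth_rewrite 1 [← ENNReal.ofReal_toReal hx']
  rw [← ENNReal.ofReal_mul ENNReal.toReal_nonneg, ENNReal.ofReal_le_one]
  have := Real.log_le_sub_one_of_pos (x := x.toReal⁻¹) (by positivity)
  rw [Real.log_inv] at this
  have h2 := mul_le_mul_of_nonneg_left this hpos.le
  have h3 : x.toReal * (x.toReal⁻¹ - 1) = 1 - x.toReal := by field_simp
  linarith

theorem crossEntropy_self_le_card (hp : ∑ i, p i = 1) :
    crossEntropy p p ≤ Fintype.card ι := by
  calc crossEntropy p p ≤ ∑ _i : ι, 1 :=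
        Finset.sum_le_sum fun i _ => mul_negLog_self_le_one (le_one_of_sum_eq_one hp i)
    _ = Fintype.card ι := by simp

/-- If the atom `b` of a second partition meets at most `W b` atoms of a first one, then the entropy
of the first partition exceeds the entropy of the second one by at most the mean of `log W`. -/
theorem crossEntropy_self_le_add_log_card {κ : Type*} [Fintype κ] (r : ι → κ → ℝ≥0∞)
    (hr : ∑ a, ∑ b, r a b = 1) (W : κ → ℕ)
    (hW : ∀ b, W b = (Finset.univ.filter fun a => r a b ≠ 0).card) :
    crossEntropy (fun a => ∑ b, r a b) (fun a => ∑ b, r a b)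
      ≤ crossEntropy (fun b => ∑ a, r a b) (fun b => ∑ a, r a b)
        + ∑ b, (∑ a, r a b) * ENNReal.ofReal (Real.log (W b)) := by
  set p : ι → ℝ≥0∞ := fun a => ∑ b, r a b with hp_def
  set q : κ → ℝ≥0∞ := fun b => ∑ a, r a b with hq_def
  have hp : ∑ a, p a = 1 := hr
  have hq : ∑ b, q b = 1 := by rw [← hr, Finset.sum_comm]
  have hrp (a b) : r a b ≤ p a :=
    Finset.single_le_sum (f := fun b => r a b) (fun _ _ => zero_le) (Finset.mem_univ b)
  have hrq (a b) : r a b ≤ q b :=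
    Finset.single_le_sum (f := fun a => r a b) (fun _ _ => zero_le) (Finset.mem_univ a)
  have hp1 (a) : p a ≠ ⊤ := ((le_one_of_sum_eq_one hp a).trans_lt (by simp)).ne
  have hq1 (b) : q b ≠ ⊤ := ((le_one_of_sum_eq_one hq b).trans_lt (by simp)).ne
  have hr1 (a b) : r a b ≠ ⊤ := ((hrp a b).trans_lt (hp1 a).lt_top).ne
  have hlogW (b) : 0 ≤ Real.log (W b) := Real.log_natCast_nonneg _
  have hpr (a) : (p a).toReal = ∑ b, (r a b).toReal := ENNReal.toReal_sum fun b _ => hr1 a b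
  have hqr (b) : (q b).toReal = ∑ a, (r a b).toReal := ENNReal.toReal_sum fun a _ => hr1 a b
  have hW' : ∑ b, q b * ENNReal.ofReal (Real.log (W b))
      = ENNReal.ofReal (∑ b, (q b).toReal * Real.log (W b)) := by
    rw [ENNReal.ofReal_sum_of_nonneg fun b _ => mul_nonneg ENNReal.toReal_nonneg (hlogW b)]
    refine Finset.sum_congr rfl fun b _ => ?_
    rw [ENNReal.ofReal_mul ENNReal.toReal_nonneg, ENNReal.ofReal_toReal (hq1 b)]
  have hHq : 0 ≤ ∑ b, (q b).toReal * -Real.log (q b).toReal := by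
    refine Finset.sum_nonneg fun i _ => mul_nonneg ENNReal.toReal_nonneg ?_
    have := Real.log_nonpos (x := (q i).toReal) ENNReal.toReal_nonneg
      (ENNReal.toReal_le_of_le_ofReal zero_le_one (by simpa using le_one_of_sum_eq_one hq i))
    linarith
  rw [crossEntropy_eq_ofReal hp hp fun _ => id, crossEntropy_eq_ofReal hq hq fun _ => id, hW',
    ← ENNReal.ofReal_add hHq
      (Finset.sum_nonneg fun b _ => mul_nonneg ENNReal.toReal_nonneg (hlogW b))]
  apply ENNReal.ofReal_le_ofReal
  -- `log x ≤ x - 1` is applied to `x = q b / (p a * W b)`, and then `r a b ≤ p a` is used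
  have key (a b) : (r a b).toReal * -Real.log (p a).toReal
      ≤ (r a b).toReal * -Real.log (q b).toReal + (r a b).toReal * Real.log (W b)
        + ((if r a b ≠ 0 then (q b).toReal / W b else 0) - (r a b).toReal) := by
    by_cases h0 : r a b = 0
    · simp [h0]
    have hrpos : 0 < (r a b).toReal := ENNReal.toReal_pos h0 (hr1 a b)
    have hrp' : (r a b).toReal ≤ (p a).toReal := ENNReal.toReal_mono (hp1 a) (hrp a b)
    have hppos : 0 < (p a).toReal := hrpos.trans_le hrp'
    have hqpos : 0 < (q b).toReal := hrpos.trans_le (ENNReal.toReal_mono (hq1 b) (hrq a b))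
    have hWpos : (0 : ℝ) < W b := by
      rw [hW b]
      exact_mod_cast Finset.card_pos.2 ⟨a, by simp [h0]⟩
    have := Real.log_le_sub_one_of_pos (x := (q b).toReal / ((p a).toReal * W b)) (by positivity)
    rw [Real.log_div hqpos.ne' (by positivity), Real.log_mul hppos.ne' hWpos.ne'] at this
    have h2 := mul_le_mul_of_nonneg_left this hrpos.le
    have h3 : (r a b).toReal * ((q b).toReal / ((p a).toReal * W b)) ≤ (q b).toReal / W b := by
      have : (r a b).toReal * ((q b).toReal / ((p a).toReal * W b))
          = ((r a b).toReal / (p a).toReal) * ((q b).toReal / W b) := by field_simp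
      rw [this]
      exact mul_le_of_le_one_left (by positivity) ((div_le_one hppos).2 hrp')
    rw [if_pos h0]
    nlinarith
  have hsum : ∑ a, ∑ b, ((if r a b ≠ 0 then (q b).toReal / W b else 0) - (r a b).toReal) ≤ 0 := by
    have h1 : ∑ a, ∑ b, (r a b).toReal = 1 := by
      simp_rw [← hpr]
      exact sum_toReal_eq_one hp
    have h2 : ∑ a, ∑ b, (if r a b ≠ 0 then (q b).toReal / W b else 0) ≤ 1 := by
      rw [Finset.sum_comm, ← sum_toReal_eq_one hq]
      refine Finset.sum_le_sum fun b _ => ?_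
      rw [← Finset.sum_filter, Finset.sum_const, ← hW b, nsmul_eq_mul]
      rcases Nat.eq_zero_or_pos (W b) with h | h
      · simp [h]
      · have : (0 : ℝ) < W b := by exact_mod_cast h
        rw [mul_div_cancel₀ _ this.ne']
    simp only [Finset.sum_sub_distrib]
    linarith
  have h := Finset.sum_le_sum fun a (_ : a ∈ Finset.univ) =>
    Finset.sum_le_sum fun b (_ : b ∈ Finset.univ) => key a b
  have e1 : ∑ a, (p a).toReal * -Real.log (p a).toReal
      = ∑ a, ∑ b, (r a b).toReal * -Real.log (p a).toReal := by
    refine Finset.sum_congr rfl fun a _ => ?_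
    rw [← Finset.sum_mul, ← hpr]
  have e2 (f : κ → ℝ) : ∑ b, (q b).toReal * f b = ∑ a, ∑ b, (r a b).toReal * f b := by
    rw [Finset.sum_comm]
    refine Finset.sum_congr rfl fun b _ => ?_
    rw [← Finset.sum_mul, ← hqr]
  rw [e1, e2, e2]
  simp only [Finset.sum_add_distrib] at h
  linarith

end Finite

/-! ### Lower semicontinuity of the Kullback-Leibler divergence -/

/-- With `c` the truncation of `x` to `[n⁻¹, n]`, the number `x log c - (c - 1)` is nonnegative: `c`
lies between `1` and `x`. -/
theorem sub_one_le_mul_log_clamp {x : ℝ} {n : ℝ} (hn : 1 ≤ n) :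
    0 ≤ Real.log (max (min x n) n⁻¹) * x - (max (min x n) n⁻¹ - 1) := by
  set c := max (min x n) n⁻¹ with hc
  have hcpos : 0 < c := lt_of_lt_of_le (by positivity) (le_max_right _ _)
  have h1 : n⁻¹ ≤ 1 := inv_le_one_of_one_le₀ hn
  have hlow : c - 1 ≤ Real.log c * c := by
    have := Real.log_le_sub_one_of_pos (x := c⁻¹) (by positivity)
    rw [Real.log_inv] at this
    have h2 := mul_le_mul_of_nonneg_left this hcpos.le
    have h3 : c * (c⁻¹ - 1) = 1 - c := by field_simp
    linarith
  rcases le_total 1 x with h | h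
  · have hc1 : 1 ≤ c := le_max_of_le_left (le_min h hn)
    have hcx : c ≤ x := max_le (min_le_left _ _) (h1.trans h)
    have := mul_le_mul_of_nonneg_left hcx (Real.log_nonneg hc1)
    linarith
  · have hc1 : c ≤ 1 := max_le ((min_le_left _ _).trans h) h1
    have hcx : x ≤ c := by
      refine le_max_of_le_left (le_min le_rfl (h.trans hn))
    have := mul_le_mul_of_nonpos_left hcx (Real.log_nonpos hcpos.le hc1)
    linarith

/-- The duality formula for the Kullback-Leibler divergence, in the form of an upper bound: it is
enough to test the divergence against bounded measurable functions. -/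
theorem klDiv_le_of_forall_bounded {X : Type*} [MeasurableSpace X] (μ ν : Measure X)
    [IsProbabilityMeasure μ] [IsProbabilityMeasure ν] (S : ℝ≥0∞)
    (h : ∀ φ : X → ℝ, Measurable φ → (∃ b, ∀ x, |φ x| ≤ b) →
      ENNReal.ofReal (∫ x, φ x ∂μ - ∫ x, (Real.exp (φ x) - 1) ∂ν) ≤ S) :
    InformationTheory.klDiv μ ν ≤ S := by
  by_cases hac : μ ≪ ν
  · rw [InformationTheory.klDiv_eq_lintegral_klFun_of_ac hac]
    set f : X → ℝ := fun x => (μ.rnDeriv ν x).toReal with hf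
    have hfm : Measurable f := (Measure.measurable_rnDeriv μ ν).ennreal_toReal
    -- logarithms of the truncations of the density are nearly optimal test functions
    let c : ℕ → X → ℝ := fun n x => max (min (f x) (n + 1)) ((n : ℝ) + 1)⁻¹
    have hcm (n) : Measurable (c n) := by fun_prop
    have hn (n : ℕ) : (1 : ℝ) ≤ (n : ℝ) + 1 := by simp
    have hcpos (n x) : 0 < c n x := lt_of_lt_of_le (by positivity) (le_max_right _ _)
    have hcle (n x) : c n x ≤ n + 1 :=
      max_le (min_le_right _ _) ((inv_le_one_of_one_le₀ (hn n)).trans (hn n))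
    have hbd (n) : ∀ x, |Real.log (c n x)| ≤ Real.log (n + 1) := fun x => by
      rw [abs_le]
      constructor
      · rw [← Real.log_inv]
        exact Real.log_le_log (by positivity) (le_max_right _ _)
      · exact Real.log_le_log (hcpos n x) (hcle n x)
    have hlim (x) : Tendsto (fun n => ENNReal.ofReal (Real.log (c n x) * f x - (c n x - 1))) atTop
        (𝓝 (ENNReal.ofReal (InformationTheory.klFun (f x)))) := by
      refine (ENNReal.continuous_ofReal.tendsto _).comp ?_
      have hfx : 0 ≤ f x := ENNReal.toReal_nonneg
      have hc : Tendsto (fun n => c n x) atTop (𝓝 (f x)) := by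
        have h1 : Tendsto (fun n : ℕ => ((n : ℝ) + 1)⁻¹) atTop (𝓝 0) := by
          simpa using tendsto_one_div_add_atTop_nhds_zero_nat (𝕜 := ℝ)
        have h2 : Tendsto (fun n : ℕ => min (f x) ((n : ℝ) + 1)) atTop (𝓝 (f x)) := by
          refine tendsto_const_nhds.congr' ?_
          filter_upwards [eventually_ge_atTop ⌈f x⌉₊] with n hn
          rw [min_eq_left]
          have := Nat.ceil_le.1 hn
          linarith
        simpa [max_eq_left hfx] using h2.max h1
      rw [InformationTheory.klFun_apply]
      rcases hfx.eq_or_lt with h0 | h0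
      · rw [← h0] at hc ⊢
        simpa using (hc.sub_const 1).neg
      · have := ((hc.log h0.ne').mul_const (f x)).sub (hc.sub_const 1)
        convert this using 2
        ring
    calc ∫⁻ x, ENNReal.ofReal (InformationTheory.klFun (f x)) ∂ν
        = ∫⁻ x, liminf (fun n => ENNReal.ofReal (Real.log (c n x) * f x - (c n x - 1))) atTop ∂ν :=
          lintegral_congr fun x => (hlim x).liminf_eq.symm
      _ ≤ liminf (fun n => ∫⁻ x, ENNReal.ofReal (Real.log (c n x) * f x - (c n x - 1)) ∂ν) atTop :=
          lintegral_liminf_le fun n => by fun_prop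
      _ ≤ S := by
          refine liminf_le_of_frequently_le' (Frequently.of_forall fun n => ?_)
          have hfi : Integrable f ν := Measure.integrable_toReal_rnDeriv
          have hi1 : Integrable (fun x => Real.log (c n x) * f x) ν :=
            hfi.bdd_mul (hcm n).log.aestronglyMeasurable (ae_of_all _ fun x => hbd n x)
          have hi2 : Integrable (fun x => c n x - 1) ν := by
            refine Integrable.sub (Integrable.of_bound (hcm n).aestronglyMeasurable (n + 1)
              (ae_of_all _ fun x => ?_)) (integrable_const _)
            rw [Real.norm_eq_abs, abs_of_pos (hcpos n x)]
            exact hcle n x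
          have hi3 : Integrable (fun x => Real.log (c n x) * f x - (c n x - 1)) ν := hi1.sub hi2
          rw [← ofReal_integral_eq_lintegral_ofReal hi3
            (ae_of_all _ fun x => sub_one_le_mul_log_clamp (hn n)),
            integral_sub hi1 hi2]
          have h1 := h (fun x => Real.log (c n x)) (hcm n).log ⟨_, hbd n⟩
          have h2 : ∫ x, Real.log (c n x) ∂μ = ∫ x, Real.log (c n x) * f x ∂ν := by
            rw [← integral_rnDeriv_smul hac]
            refine integral_congr_ae (ae_of_all _ fun x => ?_)
            simp [hf, mul_comm]
          simp only [Real.exp_log (hcpos n _)] at h1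
          rwa [h2] at h1
  · have : ∃ A, MeasurableSet A ∧ ν A = 0 ∧ μ A ≠ 0 := by
      by_contra! hcon
      exact hac (Measure.AbsolutelyContinuous.mk fun A hA h0 => hcon A hA h0)
    obtain ⟨A, hA, hνA, hμA⟩ := this
    have hS : S = ⊤ := by
      refine ENNReal.eq_top_of_forall_nnreal_le fun r => ?_
      have hpos : 0 < μ.real A := ENNReal.toReal_pos hμA (measure_ne_top _ _)
      refine le_trans ?_ (h (A.indicator fun _ => r / μ.real A) (measurable_const.indicator hA)
        ⟨r / μ.real A, fun x => ?_⟩)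
      · have h1 : ∫ x, (Real.exp (A.indicator (fun _ => r / μ.real A) x) - 1) ∂ν = 0 := by
          refine integral_eq_zero_of_ae ?_
          have : ∀ᵐ x ∂ν, x ∉ A := measure_eq_zero_iff_ae_notMem.1 hνA
          filter_upwards [this] with x hx
          simp [hx]
        rw [h1, integral_indicator_const _ hA, smul_eq_mul, mul_div_cancel₀ _ hpos.ne', sub_zero,
          ENNReal.ofReal_coe_nnreal]
      · by_cases hx : x ∈ A
        · simp only [Set.indicator_of_mem hx]
          rw [abs_of_nonneg (by positivity)]
        · simp only [Set.indicator_of_notMem hx, abs_zero]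
          positivity
    rw [hS]
    exact le_top

theorem abs_exp_sub_exp_le {a b c : ℝ} (ha : a ≤ c) (hb : b ≤ c) :
    |Real.exp a - Real.exp b| ≤ Real.exp c * |a - b| := by
  wlog hab : b ≤ a generalizing a b
  · rw [abs_sub_comm, abs_sub_comm a]
    exact this hb ha (le_of_not_ge hab)
  rw [abs_of_nonneg (sub_nonneg.2 (Real.exp_le_exp.2 hab)), abs_of_nonneg (sub_nonneg.2 hab)]
  have h1 := Real.add_one_le_exp (b - a)
  have h2 : Real.exp b = Real.exp a * Real.exp (b - a) := by rw [← Real.exp_add]; congr 1; ring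
  have h3 := Real.exp_le_exp.2 ha
  have h4 := mul_le_mul_of_nonneg_left h1 (Real.exp_pos a).le
  nlinarith [mul_le_mul_of_nonneg_right h3 (sub_nonneg.2 hab)]

/-- The functional of the duality formula is Lipschitz on bounded functions. -/
theorem integral_sub_integral_exp_le {X : Type*} [MeasurableSpace X] (μ ν : Measure X)
    [IsProbabilityMeasure μ] [IsProbabilityMeasure ν] {φ ψ : X → ℝ} (hφ : Measurable φ)
    (hψ : Measurable ψ) {b : ℝ} (hφb : ∀ x, |φ x| ≤ b) (hψb : ∀ x, |ψ x| ≤ b) :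
    ∫ x, φ x ∂μ - ∫ x, (Real.exp (φ x) - 1) ∂ν
      ≤ (∫ x, ψ x ∂μ - ∫ x, (Real.exp (ψ x) - 1) ∂ν)
        + (∫ x, |φ x - ψ x| ∂μ + Real.exp b * ∫ x, |φ x - ψ x| ∂ν) := by
  have hi (ρ : Measure X) [IsProbabilityMeasure ρ] {θ : X → ℝ} (hθ : Measurable θ)
      (hb : ∀ x, |θ x| ≤ b) : Integrable θ ρ :=
    Integrable.of_bound hθ.aestronglyMeasurable b (ae_of_all _ hb)
  have he {θ : X → ℝ} (hθ : Measurable θ) (hb : ∀ x, |θ x| ≤ b) :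
      Integrable (fun x => Real.exp (θ x) - 1) ν := by
    refine Integrable.sub (Integrable.of_bound hθ.exp.aestronglyMeasurable (Real.exp b)
      (ae_of_all _ fun x => ?_)) (integrable_const _)
    rw [Real.norm_eq_abs, abs_of_pos (Real.exp_pos _)]
    exact Real.exp_le_exp.2 ((le_abs_self _).trans (hb x))
  have habs (ρ : Measure X) [IsProbabilityMeasure ρ] : Integrable (fun x => |φ x - ψ x|) ρ :=
    ((hi ρ hφ hφb).sub (hi ρ hψ hψb)).abs
  have h1 : ∫ x, φ x ∂μ ≤ ∫ x, ψ x ∂μ + ∫ x, |φ x - ψ x| ∂μ := by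
    rw [← integral_add (hi μ hψ hψb) (habs μ)]
    refine integral_mono (hi μ hφ hφb) ((hi μ hψ hψb).add (habs μ)) fun x => ?_
    have := le_abs_self (φ x - ψ x)
    simp only
    linarith
  have h2 : ∫ x, (Real.exp (ψ x) - 1) ∂ν
      ≤ ∫ x, (Real.exp (φ x) - 1) ∂ν + Real.exp b * ∫ x, |φ x - ψ x| ∂ν := by
    rw [← integral_const_mul, ← integral_add (he hφ hφb) ((habs ν).const_mul _)]
    refine integral_mono (he hψ hψb) ((he hφ hφb).add ((habs ν).const_mul _)) fun x => ?_
    have := abs_exp_sub_exp_le ((le_abs_self _).trans (hφb x)) ((le_abs_self _).trans (hψb x))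
    have := neg_abs_le (Real.exp (φ x) - Real.exp (ψ x))
    simp only
    linarith
  linarith

/-- On a compact metric space it is enough to test the Kullback-Leibler divergence against
continuous functions. -/
theorem klDiv_le_of_forall_continuous {X : Type*} [MetricSpace X] [CompactSpace X]
    [MeasurableSpace X] [BorelSpace X] (μ ν : Measure X)
    [IsProbabilityMeasure μ] [IsProbabilityMeasure ν] (S : ℝ≥0∞)
    (h : ∀ ψ : X → ℝ, Continuous ψ →
      ENNReal.ofReal (∫ x, ψ x ∂μ - ∫ x, (Real.exp (ψ x) - 1) ∂ν) ≤ S) :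
    InformationTheory.klDiv μ ν ≤ S := by
  refine klDiv_le_of_forall_bounded μ ν S fun φ hφ ⟨b, hb⟩ => ?_
  refine ENNReal.le_of_forall_pos_le_add fun ε hε _ => ?_
  have hφi : Integrable φ (μ + ν) :=
    Integrable.of_bound hφ.aestronglyMeasurable b (ae_of_all _ hb)
  have hεpos : 0 < (ε : ℝ) / (1 + Real.exp b) := by positivity
  obtain ⟨ψ₀, hψ₀, hψ₀i⟩ := hφi.exists_boundedContinuous_integral_sub_le hεpos
  let ψ : X → ℝ := fun x => max (min (ψ₀ x) b) (-b)
  have hψc : Continuous ψ := by fun_prop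
  have hψb (x) : |ψ x| ≤ b := by
    have : 0 ≤ b := (abs_nonneg _).trans (hb x)
    exact abs_le.2 ⟨le_max_right _ _, max_le (min_le_right _ _) (by linarith)⟩
  have hle (x) : |φ x - ψ x| ≤ |φ x - ψ₀ x| := by
    have h1 := abs_le.1 (hb x)
    have h2 : φ x = max (min (φ x) b) (-b) := by
      rw [min_eq_left h1.2, max_eq_left h1.1]
    rw [h2]
    exact (abs_max_sub_max_le_abs _ _ _).trans (by
      simpa [← h2] using abs_min_sub_min_le_max (φ x) b (ψ₀ x) b)
  have hint : Integrable (fun x => |φ x - ψ x|) (μ + ν) :=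
    (hφi.sub (Integrable.of_bound hψc.measurable.aestronglyMeasurable b (ae_of_all _ hψb))).abs
  have hsmall : ∫ x, |φ x - ψ x| ∂μ + ∫ x, |φ x - ψ x| ∂ν ≤ ε / (1 + Real.exp b) := by
    rw [← integral_add_measure hint.left_of_add_measure hint.right_of_add_measure]
    exact (integral_mono hint (hφi.sub hψ₀i).abs hle).trans hψ₀
  have hn1 : 0 ≤ ∫ x, |φ x - ψ x| ∂μ := integral_nonneg fun x => abs_nonneg _
  have hn2 : 0 ≤ ∫ x, |φ x - ψ x| ∂ν := integral_nonneg fun x => abs_nonneg _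
  have key : ∫ x, φ x ∂μ - ∫ x, (Real.exp (φ x) - 1) ∂ν
      ≤ (∫ x, ψ x ∂μ - ∫ x, (Real.exp (ψ x) - 1) ∂ν) + ε := by
    refine (integral_sub_integral_exp_le μ ν hφ hψc.measurable hb hψb).trans ?_
    rw [le_div_iff₀ (by positivity)] at hsmall
    have := Real.exp_pos b
    nlinarith [mul_nonneg hn1 this.le]
  refine (ENNReal.ofReal_le_ofReal key).trans (ENNReal.ofReal_add_le.trans ?_)
  rw [ENNReal.ofReal_coe_nnreal]
  gcongr
  exact h ψ hψc

open scoped Classical in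
/-- The Kullback-Leibler divergence on a compact metric space is bounded by the lower limit of the
relative entropies of the distributions of labels, when the cells of the labelings become small. -/
theorem klDiv_le_liminf_of_fine_labels {X : Type*} [MetricSpace X] [CompactSpace X]
    [MeasurableSpace X] [BorelSpace X] (μ ν : Measure X)
    [IsProbabilityMeasure μ] [IsProbabilityMeasure ν] (N : ℕ → ℕ) (l : ∀ k, X → Fin (N k))
    (hl : ∀ k, Measurable (l k))
    (hfine : ∀ ε > 0, ∀ᶠ k in atTop, ∀ x x', l k x = l k x' → dist x x' ≤ ε) :
    InformationTheory.klDiv μ ν ≤ liminf (fun k =>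
      crossEntropy (fun a => μ {x | l k x = a}) (fun a => ν {x | l k x = a})
        - crossEntropy (fun a => μ {x | l k x = a}) (fun a => μ {x | l k x = a})) atTop := by
  refine klDiv_le_of_forall_continuous μ ν _ fun ψ hψ => ?_
  refine ENNReal.le_of_forall_pos_le_add fun ε hε _ => ?_
  obtain ⟨b, hb⟩ : ∃ b, ∀ x, |ψ x| ≤ b := by
    obtain ⟨b, hb⟩ := (isCompact_range hψ).isBounded.exists_norm_le
    exact ⟨b, fun x => hb _ ⟨x, rfl⟩⟩
  have hexp : 0 < 1 + Real.exp b := by positivity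
  obtain ⟨δ, hδ, hδψ⟩ := Metric.uniformContinuous_iff.1
    (CompactSpace.uniformContinuous_of_continuous hψ) (ε / (1 + Real.exp b)) (by positivity)
  rw [← tsub_le_iff_right]
  refine le_liminf_of_le (by isBoundedDefault) ?_
  filter_upwards [hfine (δ / 2) (by positivity)] with k hk
  -- `ψ` is replaced by a function which is constant on the cells
  let a : Fin (N k) → ℝ := fun i => if h : ∃ x, l k x = i then ψ h.choose else 0
  have ha (x) : ∃ x', l k x' = l k x ∧ a (l k x) = ψ x' := by
    have h : ∃ x', l k x' = l k x := ⟨x, rfl⟩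
    exact ⟨h.choose, h.choose_spec, by simp only [a]; rw [dif_pos h]⟩
  have ham : Measurable fun x => a (l k x) := (measurable_of_finite a).comp (hl k)
  have hab (x) : |a (l k x)| ≤ b := by
    obtain ⟨x', -, h⟩ := ha x
    rw [h]
    exact hb x'
  have hclose (x) : |ψ x - a (l k x)| ≤ ε / (1 + Real.exp b) := by
    obtain ⟨x', hx', h⟩ := ha x
    rw [h]
    exact (hδψ (lt_of_le_of_lt (hk x x' hx'.symm) (by linarith))).le
  have hint (ρ : Measure X) [IsProbabilityMeasure ρ] :
      ∫ x, |ψ x - a (l k x)| ∂ρ ≤ ε / (1 + Real.exp b) := by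
    have := integral_mono_of_nonneg (μ := ρ) (ae_of_all _ fun x => abs_nonneg (ψ x - a (l k x)))
      (integrable_const (ε / (1 + Real.exp b))) (ae_of_all _ hclose)
    simpa using this
  have key := integral_sub_integral_exp_le μ ν hψ.measurable ham hb hab
  have hdisc (ρ : Measure X) [IsProbabilityMeasure ρ] (θ : Fin (N k) → ℝ) :
      ∫ x, θ (l k x) ∂ρ = ∑ i, θ i * (ρ {x | l k x = i}).toReal := by
    have h1 : ∫ x, θ (l k x) ∂ρ = ∫ i, θ i ∂(ρ.map (l k)) :=
      (integral_map (hl k).aemeasurable (measurable_of_finite θ).aestronglyMeasurable).symm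
    have : IsProbabilityMeasure (ρ.map (l k)) :=
      Measure.isProbabilityMeasure_map (hl k).aemeasurable
    rw [h1, integral_fintype (.of_finite)]
    refine Finset.sum_congr rfl fun i _ => ?_
    rw [smul_eq_mul, mul_comm, measureReal_def,
      Measure.map_apply (hl k) (measurableSet_singleton i)]
    rfl
  have hone (ρ : Measure X) [IsProbabilityMeasure ρ] : ∑ i, ρ {x | l k x = i} = 1 := by
    have := sum_measure_preimage_singleton (μ := ρ) (f := l k) Finset.univ
      fun i _ => hl k (measurableSet_singleton i)
    simpa [Set.preimage] using this
  have hdual := ofReal_add_crossEntropy_self_le (hone μ) (hone ν) a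
  rw [← hdisc μ a, ← hdisc ν fun i => Real.exp (a i) - 1] at hdual
  have hfin : crossEntropy (fun i => μ {x | l k x = i}) (fun i => μ {x | l k x = i}) ≠ ⊤ :=
    ((crossEntropy_self_le_card (hone μ)).trans_lt (by simp)).ne
  refine le_trans ?_ (ENNReal.le_sub_of_add_le_right hfin hdual)
  rw [tsub_le_iff_right, ← ENNReal.ofReal_coe_nnreal]
  refine (ENNReal.ofReal_le_ofReal ?_).trans ENNReal.ofReal_add_le
  refine key.trans (add_le_add le_rfl ?_)
  calc _ ≤ ε / (1 + Real.exp b) + Real.exp b * (ε / (1 + Real.exp b)) := by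
        gcongr
        · exact hint μ
        · exact hint ν
    _ = ε := by field_simp

/-! ### The fiber entropy and the distribution of labels -/

namespace RiemannianFiberBundle

variable {B : Type u} [MeasurableSpace B] {E : RiemannianFiberBundle.{u, v} B}

theorem measurable_base : Measurable (Total.base : E.Total → B) :=
  measurable_fst.comp (comap_measurable Total.trivMap)

theorem measurable_mk (y : B) : Measurable (Total.mk y : E.Fib y → E.Total) := by
  rw [measurable_comap_iff]
  refine measurable_const.prodMk ?_
  have h : Measurable (Sigma.mk (E.idx y) : E.Model (E.idx y) → Σ i, E.Model i) :=
    measurable_iff_le_map.2 (iInf_le _ (E.idx y))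
  exact h.comp (E.triv (E.idx y) y rfl).continuous.measurable

theorem lintegral_comp_label {X : Type*} [MeasurableSpace X] (ρ : Measure X) {N : ℕ}
    {l : X → Fin N} (hl : Measurable l) (h : Fin N → ℝ≥0∞) :
    ∫⁻ x, h (l x) ∂ρ = ∑ a, ρ {x | l x = a} * h a := by
  rw [← lintegral_map (f := h) (measurable_of_finite h) hl, lintegral_fintype]
  refine Finset.sum_congr rfl fun a _ => ?_
  rw [Measure.map_apply hl (measurableSet_singleton a), mul_comm]
  rfl

theorem sum_measure_label {X : Type*} [MeasurableSpace X] (ρ : Measure X) [IsProbabilityMeasure ρ]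
    {N : ℕ} {l : X → Fin N} (hl : Measurable l) : ∑ a, ρ {x | l x = a} = 1 := by
  simpa using (lintegral_comp_label ρ hl fun _ => 1).symm

namespace IsDisintegration

variable {M : Measure E.Total} {m : Measure B} {K : ∀ y, Measure (E.Fib y)}

theorem measurable_map_mk (hK : E.IsDisintegration M m K) :
    Measurable fun y => (K y).map (Total.mk y : E.Fib y → E.Total) := by
  refine Measure.measurable_of_measurable_coe _ fun A hA => ?_
  simp_rw [Measure.map_apply (measurable_mk _) hA]
  exact hK.measurable A hA

theorem lintegral_total (hK : E.IsDisintegration M m K) {Φ : E.Total → ℝ≥0∞}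
    (hΦ : Measurable Φ) : ∫⁻ p, Φ p ∂M = ∫⁻ y, ∫⁻ ξ, Φ ⟨y, ξ⟩ ∂(K y) ∂m := by
  have hM : M = m.bind fun y => (K y).map (Total.mk y : E.Fib y → E.Total) := by
    ext A hA
    rw [Measure.bind_apply hA hK.measurable_map_mk.aemeasurable, hK.lintegral_eq A hA]
    refine lintegral_congr fun y => ?_
    rw [Measure.map_apply (measurable_mk _) hA]
    rfl
  rw [hM, Measure.lintegral_bind hK.measurable_map_mk.aemeasurable hΦ.aemeasurable]
  exact lintegral_congr fun y => lintegral_map hΦ (measurable_mk y)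

end IsDisintegration

namespace DiffeoBundle

variable {g : B → B} (F : E.DiffeoBundle g) (K : ∀ y, Measure (E.Fib y))

theorem measurable_total : Measurable F.total := F.measurable_map

theorem total_iterate (n : ℕ) (y : B) (ξ : E.Fib y) :
    F.total^[n] ⟨y, ξ⟩ = ⟨g^[n] y, F.iter n y ξ⟩ := by
  induction n generalizing y ξ with
  | zero => rfl
  | succ n ih => exact ih (g y) (F.map y ξ)

/-- The probability that the `j`-th iterate of a `K y`-random point of the fiber over `y` carries
the label `a`. -/
noncomputable def labelLaw {N : ℕ} (l : E.Total → Fin N) (j : ℕ) (y : B) (a : Fin N) : ℝ≥0∞ :=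
  K y {ξ | l (F.total^[j] ⟨y, ξ⟩) = a}

/-- The number of labels carried with positive probability by points `ξ` of the fiber of `p` such
that the `n`-th iterate of `ξ` has the same label as the `n`-th iterate of `p`. -/
noncomputable def labelCount {N : ℕ} (l : E.Total → Fin N) (n : ℕ) (p : E.Total) : ℕ :=
  (Finset.univ.filter fun a => K p.base {ξ | l ⟨p.base, ξ⟩ = a ∧
    l (F.total^[n] ⟨p.base, ξ⟩) = l (F.total^[n] p)} ≠ 0).card

variable {F K} {M : Measure E.Total} {m : Measure B} {N : ℕ} {l : E.Total → Fin N}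

theorem measurable_label_iterate (hl : Measurable l) (j : ℕ) :
    Measurable fun p => l (F.total^[j] p) :=
  hl.comp (F.measurable_total.iterate j)

theorem measurable_labelLaw (hK : E.IsDisintegration M m K) (hl : Measurable l) (j : ℕ)
    (a : Fin N) : Measurable fun y => F.labelLaw K l j y a :=
  hK.measurable {p | l (F.total^[j] p) = a}
    (measurable_label_iterate hl j (measurableSet_singleton a))

theorem sum_labelLaw (hl : Measurable l) (j : ℕ) (y : B) [IsProbabilityMeasure (K y)] :
    ∑ a, F.labelLaw K l j y a = 1 :=
  sum_measure_label (K y) ((measurable_label_iterate hl j).comp (measurable_mk y))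

theorem measurable_crossEntropy {X : Type*} [MeasurableSpace X] {p q : X → Fin N → ℝ≥0∞}
    (hp : ∀ a, Measurable fun x => p x a) (hq : ∀ a, Measurable fun x => q x a) :
    Measurable fun x => crossEntropy (p x) (q x) := by
  unfold crossEntropy
  exact Finset.measurable_fun_sum _ fun a _ => (hp a).mul (measurable_negLog.comp (hq a))

/-- By invariance of the measure, the entropy of the labels of the `j`-th iterates is the mean
surprisal of the label of the `j + 1`-st iterate given the image of the base point. -/
theorem lintegral_crossEntropy_labelLaw_succ (hK : E.IsDisintegration M m K)
    (hM : MeasurePreserving F.total M M) (hl : Measurable l) (j : ℕ) :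
    ∫⁻ y, crossEntropy (F.labelLaw K l (j + 1) y) (F.labelLaw K l j (g y)) ∂m
      = ∫⁻ y, crossEntropy (F.labelLaw K l j y) (F.labelLaw K l j y) ∂m := by
  let Ψ : E.Total → ℝ≥0∞ := fun p => negLog (F.labelLaw K l j p.base (l (F.total^[j] p)))
  have hΨ : Measurable Ψ := by
    have h1 : Measurable fun q : E.Total × Fin N => F.labelLaw K l j q.1.base q.2 :=
      measurable_from_prod_countable_left fun a =>
        (measurable_labelLaw hK hl j a).comp measurable_base
    exact measurable_negLog.comp
      (h1.comp (measurable_id.prodMk (measurable_label_iterate hl j)))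
  have e1 : ∫⁻ p, Ψ p ∂M
      = ∫⁻ y, crossEntropy (F.labelLaw K l j y) (F.labelLaw K l j y) ∂m := by
    rw [hK.lintegral_total hΨ]
    refine lintegral_congr fun y => ?_
    exact lintegral_comp_label (K y) ((measurable_label_iterate hl j).comp (measurable_mk y))
      fun a => negLog (F.labelLaw K l j y a)
  have e2 : ∫⁻ p, Ψ (F.total p) ∂M
      = ∫⁻ y, crossEntropy (F.labelLaw K l (j + 1) y) (F.labelLaw K l j (g y)) ∂m := by
    refine (hK.lintegral_total (hΨ.comp F.measurable_total)).trans (lintegral_congr fun y => ?_)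
    exact lintegral_comp_label (K y)
      ((measurable_label_iterate hl (j + 1)).comp (measurable_mk y))
      fun a => negLog (F.labelLaw K l j (g y) a)
  rw [← e1, ← e2]
  exact hM.lintegral_comp hΨ

theorem measurable_labelCount (hK : E.IsDisintegration M m K) (hl : Measurable l) (n : ℕ) :
    Measurable fun p => F.labelCount K l n p := by
  have h1 : Measurable fun q : E.Total × Fin N => (Finset.univ.filter fun a =>
      K q.1.base {ξ | l ⟨q.1.base, ξ⟩ = a ∧ l (F.total^[n] ⟨q.1.base, ξ⟩) = q.2} ≠ 0).card := by
    refine measurable_from_prod_countable_left fun b => ?_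
    simp only [Finset.card_filter]
    refine Finset.measurable_fun_sum _ fun a _ => ?_
    refine Measurable.ite ?_ measurable_const measurable_const
    have h2 : Measurable fun y => K y {ξ | l ⟨y, ξ⟩ = a ∧ l (F.total^[n] ⟨y, ξ⟩) = b} :=
      hK.measurable {p | l p = a ∧ l (F.total^[n] p) = b}
        ((hl (measurableSet_singleton a)).inter
          (measurable_label_iterate hl n (measurableSet_singleton b)))
    exact ((h2.comp measurable_base) (measurableSet_singleton 0)).compl
  exact h1.comp (measurable_id.prodMk (measurable_label_iterate hl n))

/-- In a single fiber, the labels of the points carry at most the entropy of the labels of their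
`n`-th iterates and the mean logarithm of the number of compatible labels. -/
theorem crossEntropy_labelLaw_zero_le (hl : Measurable l) (n : ℕ) (y : B)
    [IsProbabilityMeasure (K y)] :
    crossEntropy (F.labelLaw K l 0 y) (F.labelLaw K l 0 y)
      ≤ crossEntropy (F.labelLaw K l n y) (F.labelLaw K l n y)
        + ∫⁻ ξ, ENNReal.ofReal (Real.log (F.labelCount K l n ⟨y, ξ⟩)) ∂(K y) := by
  have hm (j) : Measurable fun ξ : E.Fib y => l (F.total^[j] ⟨y, ξ⟩) :=
    (measurable_label_iterate hl j).comp (measurable_mk y)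
  let r : Fin N → Fin N → ℝ≥0∞ := fun a b =>
    K y {ξ | l ⟨y, ξ⟩ = a ∧ l (F.total^[n] ⟨y, ξ⟩) = b}
  have hr1 (a) : ∑ b, r a b = F.labelLaw K l 0 y a := by
    have h := lintegral_comp_label ((K y).restrict {ξ | l ⟨y, ξ⟩ = a}) (hm n) fun _ => 1
    simp only [lintegral_one, Measure.restrict_apply_univ, mul_one] at h
    change _ = K y {ξ | l ⟨y, ξ⟩ = a}
    rw [h]
    refine Finset.sum_congr rfl fun b _ => ?_
    refine Eq.trans ?_ (Measure.restrict_apply (hm n (measurableSet_singleton b))).symm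
    exact congrArg _ (Set.inter_comm _ _)
  have hr2 (b) : ∑ a, r a b = F.labelLaw K l n y b := by
    have h := lintegral_comp_label ((K y).restrict {ξ | l (F.total^[n] ⟨y, ξ⟩) = b}) (hm 0)
      fun _ => 1
    simp only [lintegral_one, Measure.restrict_apply_univ, mul_one] at h
    change _ = K y {ξ | l (F.total^[n] ⟨y, ξ⟩) = b}
    rw [h]
    refine Finset.sum_congr rfl fun a _ => ?_
    exact (Measure.restrict_apply (hm 0 (measurableSet_singleton a))).symm
  have h := crossEntropy_self_le_add_log_card r
    (by simp_rw [hr1]; exact sum_labelLaw hl 0 y) _ fun b => rfl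
  simp_rw [hr1, hr2] at h
  refine h.trans (add_le_add le_rfl (le_of_eq ?_))
  exact (lintegral_comp_label (K y) (hm n) fun b => ENNReal.ofReal (Real.log
    ((Finset.univ.filter fun a => r a b ≠ 0).card))).symm

/-- The mean relative entropies of the labels of the iterates of order `1, …, n` telescope; their
sum is bounded by the mean logarithm of the number of labels compatible with the label of the `n`-th
iterate. -/
theorem sum_lintegral_crossEntropy_sub_le (hK : E.IsDisintegration M m K)
    [IsProbabilityMeasure m] (hM : MeasurePreserving F.total M M) (hm : MeasurePreserving g m m)
    (hl : Measurable l) (n : ℕ) :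
    ∑ j ∈ Finset.range n, ∫⁻ y,
        (crossEntropy (F.labelLaw K l (j + 1) y) (F.labelLaw K l j (g y))
          - crossEntropy (F.labelLaw K l (j + 1) y) (F.labelLaw K l (j + 1) y)) ∂m
      ≤ ∫⁻ p, ENNReal.ofReal (Real.log (F.labelCount K l n p)) ∂M := by
  let H : ℕ → ℝ≥0∞ := fun j => ∫⁻ y, crossEntropy (F.labelLaw K l j y) (F.labelLaw K l j y) ∂m
  have hlaw (j) (a) := measurable_labelLaw (F := F) hK hl j a
  have hstep (j : ℕ) : ∫⁻ y,
        (crossEntropy (F.labelLaw K l (j + 1) y) (F.labelLaw K l j (g y))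
          - crossEntropy (F.labelLaw K l (j + 1) y) (F.labelLaw K l (j + 1) y)) ∂m
        + H (j + 1) = H j := by
    rw [← lintegral_add_right _ (measurable_crossEntropy (hlaw (j + 1)) (hlaw (j + 1))),
      show H j = _ from (lintegral_crossEntropy_labelLaw_succ hK hM hl j).symm]
    refine lintegral_congr_ae ?_
    filter_upwards [hK.isProbabilityMeasure,
      hm.quasiMeasurePreserving.ae hK.isProbabilityMeasure] with y hy hgy
    exact tsub_add_cancel_of_le
      (crossEntropy_self_le (sum_labelLaw hl (j + 1) y) (sum_labelLaw hl j (g y)))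
  have hsum : ∑ j ∈ Finset.range n, ∫⁻ y,
        (crossEntropy (F.labelLaw K l (j + 1) y) (F.labelLaw K l j (g y))
          - crossEntropy (F.labelLaw K l (j + 1) y) (F.labelLaw K l (j + 1) y)) ∂m
        + H n = H 0 := by
    induction n with
    | zero => simp
    | succ n ih => rw [Finset.sum_range_succ, add_assoc, hstep, ih]
  have hHn : H n ≠ ⊤ := by
    refine ne_top_of_le_ne_top (b := ∫⁻ _, (N : ℝ≥0∞) ∂m) (by simp) (lintegral_mono_ae ?_)
    filter_upwards [hK.isProbabilityMeasure] with y hy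
    simpa using crossEntropy_self_le_card (sum_labelLaw (F := F) hl n y)
  have hlogm : Measurable fun p => ENNReal.ofReal (Real.log (F.labelCount K l n p)) :=
    ENNReal.measurable_ofReal.comp ((measurable_of_countable
      fun k : ℕ => Real.log k).comp (measurable_labelCount hK hl n))
  have hH0 : H 0 ≤ ∫⁻ p, ENNReal.ofReal (Real.log (F.labelCount K l n p)) ∂M + H n := by
    rw [hK.lintegral_total hlogm, add_comm,
      ← lintegral_add_left (measurable_crossEntropy (hlaw n) (hlaw n))]
    refine lintegral_mono_ae ?_
    filter_upwards [hK.isProbabilityMeasure] with y hy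
    exact crossEntropy_labelLaw_zero_le hl n y
  exact (ENNReal.add_le_add_iff_right hHn).1 (hsum.le.trans hH0)

/-- For labelings whose cells in the fibers become small, the fiber entropy of `n` steps is bounded
by the asymptotic mean logarithm of the number of labels compatible with the label of the `n`-th
iterate. -/
theorem mul_fiberEntropy_le_liminf (hK : E.IsDisintegration M m K)
    [IsProbabilityMeasure m] (hM : MeasurePreserving F.total M M) (hm : MeasurePreserving g m m)
    (N : ℕ → ℕ) (l : ∀ k, E.Total → Fin (N k)) (hl : ∀ k, Measurable (l k))
    (hfine : ∀ ε > 0, ∀ᶠ k in atTop, ∀ (y : B) (ξ ξ' : E.Fib y),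
      l k ⟨y, ξ⟩ = l k ⟨y, ξ'⟩ → dist ξ ξ' ≤ ε) (n : ℕ) :
    n * F.fiberEntropy m K ≤
      liminf (fun k => ∫⁻ p, ENNReal.ofReal (Real.log (F.labelCount K (l k) n p)) ∂M) atTop := by
  let D : ℕ → ℕ → B → ℝ≥0∞ := fun j k y =>
    crossEntropy (F.labelLaw K (l k) (j + 1) y) (F.labelLaw K (l k) j (g y))
      - crossEntropy (F.labelLaw K (l k) (j + 1) y) (F.labelLaw K (l k) (j + 1) y)
  have hDm (j k) : AEMeasurable (D j k) m := by
    have hlaw (j) (a) := measurable_labelLaw (F := F) hK (hl k) j a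
    exact ((measurable_crossEntropy (hlaw (j + 1)) fun a => (hlaw j a).comp hm.measurable).sub
      (measurable_crossEntropy (hlaw (j + 1)) (hlaw (j + 1)))).aemeasurable
  have hle (j : ℕ) : F.fiberEntropy m K ≤ liminf (fun k => ∫⁻ y, D j k y ∂m) atTop := by
    refine le_trans (lintegral_mono_ae ?_) (lintegral_liminf_le' (hDm j))
    filter_upwards [hK.isProbabilityMeasure,
      hm.quasiMeasurePreserving.ae hK.isProbabilityMeasure] with y hy hgy
    have hFm : Measurable (F.map y) := (F.map y).continuous.measurable
    have : IsProbabilityMeasure ((K y).map (F.map y)) :=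
      Measure.isProbabilityMeasure_map hFm.aemeasurable
    have hlm (k) : Measurable fun η : E.Fib (g y) => l k (F.total^[j] ⟨g y, η⟩) :=
      (measurable_label_iterate (hl k) j).comp (measurable_mk (g y))
    refine (klDiv_le_liminf_of_fine_labels _ _ N
      (fun k η => l k (F.total^[j] ⟨g y, η⟩)) hlm fun ε hε => ?_).trans_eq ?_
    · -- the inverse of the `j`-th iterate is uniformly continuous
      obtain ⟨δ, hδ, h⟩ := Metric.uniformContinuous_iff.1
        (CompactSpace.uniformContinuous_of_continuous (F.iter j (g y)).symm.continuous) ε hε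
      filter_upwards [hfine (δ / 2) (by positivity)] with k hk η η' hηη'
      rw [total_iterate, total_iterate] at hηη'
      have := h (lt_of_le_of_lt (hk _ _ _ hηη') (by linarith))
      rw [Diffeomorph.symm_apply_apply, Diffeomorph.symm_apply_apply] at this
      exact this.le
    · have (k) (a) : (K y).map (F.map y) {η | l k (F.total^[j] ⟨g y, η⟩) = a}
          = F.labelLaw K (l k) (j + 1) y a :=
        Measure.map_apply hFm (hlm k (measurableSet_singleton a))
      simp_rw [this]
      rfl
  rcases Nat.eq_zero_or_pos n with rfl | hn
  · simp
  have hn0 : (n : ℝ≥0∞) ≠ 0 := by exact_mod_cast hn.ne'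
  rw [mul_comm, ← ENNReal.le_div_iff_mul_le (Or.inl hn0) (Or.inl (by simp))]
  refine le_of_forall_lt fun c hc => ?_
  obtain ⟨c', hcc', hc'⟩ := exists_between hc
  refine hcc'.trans_le ?_
  rw [ENNReal.le_div_iff_mul_le (Or.inl hn0) (Or.inl (by simp)), mul_comm]
  refine le_liminf_of_le (by isBoundedDefault) ?_
  have hev : ∀ᶠ k in atTop, ∀ j ∈ Finset.range n, c' < ∫⁻ y, D j k y ∂m :=
    (Finset.eventually_all _).2 fun j _ => eventually_lt_of_lt_liminf (hc'.trans_le (hle j))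
  filter_upwards [hev] with k hk
  refine le_trans ?_ (sum_lintegral_crossEntropy_sub_le hK hM hm (hl k) n)
  calc (n : ℝ≥0∞) * c' = ∑ j ∈ Finset.range n, c' := by simp
    _ ≤ _ := Finset.sum_le_sum fun j hj => (hk j hj).le

end DiffeoBundle

end RiemannianFiberBundle

/-! ### Lengths of paths and Lipschitz estimates on Riemannian manifolds -/

section Path

variable {E : Type*} [NormedAddCommGroup E] [NormedSpace ℝ E] {H : Type*} [TopologicalSpace H]
  {I : ModelWithCorners ℝ E H}
  {E' : Type*} [NormedAddCommGroup E'] [NormedSpace ℝ E'] {H' : Type*} [TopologicalSpace H']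
  {I' : ModelWithCorners ℝ E' H'} {M' : Type*} [PseudoEMetricSpace M'] [ChartedSpace H' M']
  [RiemannianBundle (fun x : M' => TangentSpace I' x)] [IsRiemannianManifold I' M']

/-- A map with derivative bounded by `c` increases lengths of paths by at most the factor `c`. -/
theorem edist_le_mul_pathELength {M : Type*} [TopologicalSpace M] [ChartedSpace H M]
    [RiemannianBundle (fun x : M => TangentSpace I x)] {h : M → M'} {U : Set M} (hU : IsOpen U)
    (hh : ContMDiffOn I I' 1 h U) {c : ℝ≥0}
    (hc : ∀ x ∈ U, ∀ v : TangentSpace I x, ‖mfderiv I I' h x v‖ ≤ c * ‖v‖) {γ : ℝ → M} {a b : ℝ}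
    (hab : a ≤ b) (hγ : ContMDiffOn 𝓘(ℝ, ℝ) I 1 γ (Set.Icc a b))
    (hmaps : Set.MapsTo γ (Set.Icc a b) U) :
    edist (h (γ a)) (h (γ b)) ≤ c * pathELength I γ a b := by
  rcases hab.eq_or_lt with rfl | hab'
  · simp
  rw [IsRiemannianManifold.out (I := I') (h (γ a)) (h (γ b))]
  refine (riemannianEDist_le_pathELength (γ := h ∘ γ) (hh.comp hγ hmaps) rfl rfl hab).trans ?_
  rw [pathELength_eq_lintegral_mfderivWithin_Icc, pathELength_eq_lintegral_mfderivWithin_Icc,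
    ← lintegral_const_mul' _ _ ENNReal.coe_ne_top]
  refine setLIntegral_mono' measurableSet_Icc fun t ht => ?_
  have hd : mfderivWithin 𝓘(ℝ, ℝ) I' (h ∘ γ) (Set.Icc a b) t
      = (mfderiv I I' h (γ t)) ∘L (mfderivWithin 𝓘(ℝ, ℝ) I γ (Set.Icc a b) t) := by
    refine mfderiv_comp_mfderivWithin t ?_ (hγ.mdifferentiableOn one_ne_zero t ht) ?_
    · exact ((hh (γ t) (hmaps ht)).contMDiffAt (hU.mem_nhds (hmaps ht))).mdifferentiableAt
        one_ne_zero
    · rw [uniqueMDiffWithinAt_iff_uniqueDiffWithinAt]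
      exact uniqueDiffOn_Icc hab' t ht
  rw [hd]
  have := hc (γ t) (hmaps ht) (mfderivWithin 𝓘(ℝ, ℝ) I γ (Set.Icc a b) t 1)
  rw [← ofReal_norm, ← ofReal_norm, ← ENNReal.ofReal_coe_nnreal,
    ← ENNReal.ofReal_mul (NNReal.coe_nonneg c)]
  exact ENNReal.ofReal_le_ofReal this

variable {M : Type*} [MetricSpace M] [ChartedSpace H M]
  [RiemannianBundle (fun x : M => TangentSpace I x)] [IsRiemannianManifold I M]

theorem exists_path_of_edist_lt {x x' : M} {L : ℝ≥0∞} (h : edist x x' < L) :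
    ∃ γ : ℝ → M, γ 0 = x ∧ γ 1 = x' ∧ ContMDiffOn 𝓘(ℝ, ℝ) I 1 γ (Set.Icc 0 1) ∧
      pathELength I γ 0 1 < L := by
  rw [IsRiemannianManifold.out (I := I) x x'] at h
  exact exists_lt_of_riemannianEDist_lt h

/-- A `C^1` map between Riemannian manifolds with derivative bounded by `c` is `c`-Lipschitz. -/
theorem lipschitzWith_of_norm_mfderiv_le {h : M → M'}
    (hh : ContMDiff I I' 1 h) {c : ℝ≥0}
    (hc : ∀ x, ∀ v : TangentSpace I x, ‖mfderiv I I' h x v‖ ≤ c * ‖v‖) : LipschitzWith c h := by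
  intro x x'
  have key : ∀ L, edist x x' < L → edist (h x) (h x') ≤ c * L := by
    intro L hL
    obtain ⟨γ, h0, h1, hγ, hlen⟩ := exists_path_of_edist_lt (I := I) hL
    have := edist_le_mul_pathELength isOpen_univ hh.contMDiffOn (fun x _ => hc x) zero_le_one hγ
      (Set.mapsTo_univ _ _)
    rw [h0, h1] at this
    exact this.trans (by gcongr)
  refine ENNReal.le_of_forall_pos_le_add fun ε hε hfin => ?_
  have hpos : (0 : ℝ≥0∞) < ε / (c + 1) :=
    ENNReal.div_pos (by exact_mod_cast hε.ne') (by simp)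
  have := key (edist x x' + ε / (c + 1)) (ENNReal.lt_add_right (edist_ne_top _ _) hpos.ne')
  refine this.trans ?_
  rw [mul_add]
  gcongr
  calc (c : ℝ≥0∞) * (ε / (c + 1)) ≤ (c + 1) * (ε / (c + 1)) := by gcongr; simp
    _ = ε := ENNReal.mul_div_cancel (by simp) (by simp)

end Path

/-- The point at a prescribed distance of the end of a nearly minimizing path. -/
theorem exists_intermediate_point {n : ℕ} {M : Type*} [MetricSpace M]
    [ChartedSpace (EuclideanSpace ℝ (Fin n)) M]
    [RiemannianBundle (fun x : M => TangentSpace (𝓡 n) x)] (hM : IsRiemannianManifold (𝓡 n) M)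
    {x x' : M} {L s : ℝ} (hxx' : dist x x' < L) (hs : 0 < s)
    (hsx : s ≤ dist x x') : ∃ z : M, dist x z < L - s ∧ dist z x' = s := by
  have hL : 0 < L := dist_nonneg.trans_lt hxx'
  obtain ⟨γ, h0, h1, hγ, hlen⟩ := exists_path_of_edist_lt (I := 𝓡 n) (x := x) (x' := x')
    (L := ENNReal.ofReal L) (by rw [edist_dist]; exact (ENNReal.ofReal_lt_ofReal_iff hL).2 hxx')
  have hcont : ContinuousOn (fun t : ℝ => dist (γ t) x') (Set.Icc 0 1) :=
    continuous_dist.comp_continuousOn (hγ.continuousOn.prodMk continuousOn_const)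
  obtain ⟨t, ht, htd⟩ : s ∈ (fun t : ℝ => dist (γ t) x') '' Set.Icc 0 1 := by
    refine intermediate_value_Icc' zero_le_one hcont ⟨?_, ?_⟩
    · simpa only [h1, dist_self] using hs.le
    · simpa only [h0] using hsx
  refine ⟨γ t, ?_, htd⟩
  have hle {a b : ℝ} (ha : 0 ≤ a) (hab : a ≤ b) (hb : b ≤ 1) :
      edist (γ a) (γ b) ≤ pathELength (𝓡 n) γ a b := by
    rw [IsRiemannianManifold.out (I := 𝓡 n) (γ a) (γ b)]
    exact riemannianEDist_le_pathELength (hγ.mono (Set.Icc_subset_Icc ha hb)) rfl rfl hab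
  have hlt : edist (γ 0) (γ t) + edist (γ t) (γ 1) < ENNReal.ofReal L := by
    refine lt_of_le_of_lt ?_ hlen
    rw [← pathELength_add ht.1 ht.2]
    exact add_le_add (hle le_rfl ht.1 ht.2) (hle ht.1 ht.2 le_rfl)
  rw [edist_dist, edist_dist, ← ENNReal.ofReal_add dist_nonneg dist_nonneg,
    ENNReal.ofReal_lt_ofReal_iff hL, h0, h1] at hlt
  have htd' : dist (γ t) x' = s := htd
  linarith

/-! ### Metric estimates in a chart -/

/-- A smooth chart centered at `ξ` whose image contains the ball of radius `r`, and which distorts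
the Riemannian norm on this ball by at most the factor `c`. -/
structure IsNormalChart {n : ℕ} {M : Type*} [MetricSpace M]
    [ChartedSpace (EuclideanSpace ℝ (Fin n)) M]
    [RiemannianBundle (fun x : M => TangentSpace (𝓡 n) x)]
    (φ : OpenPartialHomeomorph M (EuclideanSpace ℝ (Fin n))) (ξ : M) (r : ℝ) (c : ℝ≥0) : Prop where
  mem_atlas : φ ∈ IsManifold.maximalAtlas (𝓡 n) ∞ M
  mem_source : ξ ∈ φ.source
  map_center : φ ξ = 0
  ball_subset : Metric.ball 0 r ⊆ φ.target
  norm_mfderiv_symm_le : ∀ u ∈ Metric.ball (0 : EuclideanSpace ℝ (Fin n)) r,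
    ∀ v : TangentSpace (𝓡 n) u, ‖mfderiv (𝓡 n) (𝓡 n) φ.symm u v‖ ≤ c * ‖v‖
  norm_le_mfderiv_symm : ∀ u ∈ Metric.ball (0 : EuclideanSpace ℝ (Fin n)) r,
    ∀ v : TangentSpace (𝓡 n) u, ‖v‖ ≤ c * ‖mfderiv (𝓡 n) (𝓡 n) φ.symm u v‖

namespace IsNormalChart

variable {n : ℕ} {M : Type*} [MetricSpace M] [ChartedSpace (EuclideanSpace ℝ (Fin n)) M]
  [RiemannianBundle (fun x : M => TangentSpace (𝓡 n) x)]
  {φ : OpenPartialHomeomorph M (EuclideanSpace ℝ (Fin n))} {ξ : M} {r : ℝ} {c : ℝ≥0}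

theorem mdifferentiable (hφ : IsNormalChart φ ξ r c) : φ.MDifferentiable (𝓡 n) (𝓡 n) :=
  ⟨(contMDiffOn_of_mem_maximalAtlas hφ.mem_atlas).mdifferentiableOn (by simp),
    (contMDiffOn_symm_of_mem_maximalAtlas hφ.mem_atlas).mdifferentiableOn (by simp)⟩

theorem isOpen_domain (_hφ : IsNormalChart φ ξ r c) :
    IsOpen (φ.source ∩ φ ⁻¹' Metric.ball 0 r) :=
  φ.isOpen_inter_preimage Metric.isOpen_ball

theorem norm_mfderiv_le [IsManifold (𝓡 n) ∞ M] (hφ : IsNormalChart φ ξ r c) {x : M}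
    (hx : x ∈ φ.source ∩ φ ⁻¹' Metric.ball 0 r) (w : TangentSpace (𝓡 n) x) :
    ‖mfderiv (𝓡 n) (𝓡 n) φ x w‖ ≤ c * ‖w‖ := by
  obtain ⟨u, hu, rfl⟩ : ∃ u ∈ Metric.ball (0 : EuclideanSpace ℝ (Fin n)) r, φ.symm u = x :=
    ⟨φ x, hx.2, φ.left_inv hx.1⟩
  have hut : φ (φ.symm u) = u := φ.right_inv (hφ.ball_subset hu)
  let A : EuclideanSpace ℝ (Fin n) → EuclideanSpace ℝ (Fin n) →L[ℝ] EuclideanSpace ℝ (Fin n) :=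
    fun z => mfderiv (𝓡 n) (𝓡 n) φ.symm z
  let v : EuclideanSpace ℝ (Fin n) := mfderiv (𝓡 n) (𝓡 n) φ (φ.symm u) w
  have h1 : A (φ (φ.symm u)) v = w :=
    congrArg (fun L => L w) (hφ.mdifferentiable.symm_comp_deriv hx.1)
  rw [hut] at h1
  have h2 := hφ.norm_le_mfderiv_symm u hu v
  have h3 : mfderiv (𝓡 n) (𝓡 n) φ.symm u v = w := h1
  rw [h3] at h2
  have e1 : ‖(show TangentSpace (𝓡 n) u from v)‖ = ‖v‖ := norm_tangentSpace_vectorSpace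
  have e2 : ‖mfderiv (𝓡 n) (𝓡 n) φ (φ.symm u) w‖ = ‖v‖ := norm_tangentSpace_vectorSpace
  exact e2.le.trans (e1.ge.trans h2)

theorem dist_symm_le [IsRiemannianManifold (𝓡 n) M] (hφ : IsNormalChart φ ξ r c)
    {u v : EuclideanSpace ℝ (Fin n)} (hu : u ∈ Metric.ball 0 r) (hv : v ∈ Metric.ball 0 r) :
    dist (φ.symm u) (φ.symm v) ≤ c * dist u v := by
  let γ : ℝ → EuclideanSpace ℝ (Fin n) := ContinuousAffineMap.lineMap (R := ℝ) u v
  have hγ : ContMDiffOn 𝓘(ℝ, ℝ) (𝓡 n) 1 γ (Set.Icc 0 1) := by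
    rw [contMDiffOn_iff_contDiffOn]
    exact (ContinuousAffineMap.contDiff _).contDiffOn
  have hmaps : Set.MapsTo γ (Set.Icc 0 1) (Metric.ball 0 r) := by
    rw [Set.mapsTo_iff_image_subset]
    simp only [γ, ContinuousAffineMap.coe_lineMap_eq, ← segment_eq_image_lineMap]
    exact (convex_ball _ _).segment_subset hu hv
  have hs : ContMDiffOn (𝓡 n) (𝓡 n) 1 φ.symm (Metric.ball 0 r) :=
    ((contMDiffOn_symm_of_mem_maximalAtlas hφ.mem_atlas).of_le (by simp)).mono hφ.ball_subset
  have h := edist_le_mul_pathELength Metric.isOpen_ball hs hφ.norm_mfderiv_symm_le zero_le_one hγ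
    hmaps
  have hlen : pathELength (𝓡 n) γ 0 1 = edist u v := by
    rw [pathELength_eq_lintegral_mfderivWithin_Icc, ← lintegral_fderiv_lineMap_eq_edist]
    simp only [mfderivWithin_eq_fderivWithin, enorm_tangentSpace_vectorSpace]
    rfl
  have h0 : γ 0 = u := by simp [γ, ContinuousAffineMap.coe_lineMap_eq]
  have h1 : γ 1 = v := by simp [γ, ContinuousAffineMap.coe_lineMap_eq]
  rw [hlen, h0, h1, edist_dist, edist_dist, ← ENNReal.ofReal_coe_nnreal,
    ← ENNReal.ofReal_mul (NNReal.coe_nonneg c)] at h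
  exact (ENNReal.ofReal_le_ofReal_iff (by positivity)).1 h

/-- A path that starts at the center and has length at most `L` with `c * L < r` stays in the domain
of the chart, and its end has Euclidean norm at most `c * L` there. -/
theorem norm_le_of_path [IsManifold (𝓡 n) ∞ M] (hφ : IsNormalChart φ ξ r c) {γ : ℝ → M}
    {L : ℝ} (hL : 0 ≤ L) (h0 : γ 0 = ξ)
    (hγ : ContMDiffOn 𝓘(ℝ, ℝ) (𝓡 n) 1 γ (Set.Icc 0 1))
    (hlen : pathELength (𝓡 n) γ 0 1 ≤ ENNReal.ofReal L) (hLr : c * L < r) :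
    γ 1 ∈ φ.source ∧ ‖φ (γ 1)‖ ≤ c * L := by
  set U : Set M := φ.source ∩ φ ⁻¹' Metric.ball 0 r with hU
  have hs : ContMDiffOn (𝓡 n) (𝓡 n) 1 φ U :=
    ((contMDiffOn_of_mem_maximalAtlas hφ.mem_atlas).of_le (by simp)).mono Set.inter_subset_left
  -- as long as the path remains in the domain, its image remains in the ball of radius `c * L`
  have key (t : ℝ) (ht : t ∈ Set.Icc (0 : ℝ) 1) (hmaps : Set.MapsTo γ (Set.Icc 0 t) U) :
      ‖φ (γ t)‖ ≤ c * L := by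
    have h := edist_le_mul_pathELength hφ.isOpen_domain hs
      (fun x hx => hφ.norm_mfderiv_le hx) ht.1 (hγ.mono (Set.Icc_subset_Icc le_rfl ht.2)) hmaps
    have h2 : pathELength (𝓡 n) γ 0 t ≤ ENNReal.ofReal L :=
      (pathELength_mono le_rfl ht.2).trans hlen
    have h3 := h.trans (mul_le_mul_right h2 _)
    rw [h0, hφ.map_center, edist_dist, ← ENNReal.ofReal_coe_nnreal,
      ← ENNReal.ofReal_mul (NNReal.coe_nonneg c), ENNReal.ofReal_le_ofReal_iff (by positivity),
      dist_zero_left] at h3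
    exact h3
  have hr : 0 < r := lt_of_le_of_lt (by positivity) hLr
  -- the first exit time leads to a contradiction
  have hall : Set.MapsTo γ (Set.Icc 0 1) U := by
    by_contra hcon
    have hbad : (Set.Icc (0 : ℝ) 1 ∩ γ ⁻¹' Uᶜ).Nonempty := by
      simp only [Set.MapsTo, not_forall] at hcon
      obtain ⟨t, ht, htU⟩ := hcon
      exact ⟨t, ht, htU⟩
    have hclosed : IsClosed (Set.Icc (0 : ℝ) 1 ∩ γ ⁻¹' Uᶜ) :=
      hγ.continuousOn.preimage_isClosed_of_isClosed isClosed_Icc hφ.isOpen_domain.isClosed_compl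
    have hcompact : IsCompact (Set.Icc (0 : ℝ) 1 ∩ γ ⁻¹' Uᶜ) :=
      isCompact_Icc.of_isClosed_subset hclosed Set.inter_subset_left
    obtain ⟨t, ⟨ht, htU⟩, hmin⟩ := hcompact.exists_isLeast hbad
    have hbefore {s : ℝ} (hs0 : 0 ≤ s) (hst : s < t) : γ s ∈ U := by
      by_contra hsU
      exact absurd (hmin ⟨⟨hs0, hst.le.trans ht.2⟩, hsU⟩) (not_le.2 hst)
    have ht0 : 0 < t := by
      rcases ht.1.eq_or_lt with h | h
      · exfalso
        apply htU
        rw [← h, h0]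
        exact ⟨hφ.mem_source, by simp [hφ.map_center, hr]⟩
      · exact h
    -- the image under `φ.symm` of the closed ball of radius `c * L` is compact
    have hsub : Metric.closedBall (0 : EuclideanSpace ℝ (Fin n)) (c * L) ⊆ φ.target :=
      (Metric.closedBall_subset_ball hLr).trans hφ.ball_subset
    have hK : IsCompact (φ.symm '' Metric.closedBall 0 (c * L)) :=
      (isCompact_closedBall _ _).image_of_continuousOn (φ.continuousOn_symm.mono hsub)
    have hev : ∀ᶠ s in 𝓝[Set.Ico 0 t] t, γ s ∈ φ.symm '' Metric.closedBall 0 (c * L) := by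
      filter_upwards [self_mem_nhdsWithin] with s hs
      have hsU := hbefore hs.1 hs.2
      refine ⟨φ (γ s), ?_, φ.left_inv hsU.1⟩
      rw [mem_closedBall_zero_iff]
      exact key s ⟨hs.1, hs.2.le.trans ht.2⟩ fun s' hs' => hbefore hs'.1 (hs'.2.trans_lt hs.2)
    have hlim : Tendsto γ (𝓝[Set.Ico 0 t] t) (𝓝 (γ t)) :=
      (hγ.continuousOn t ht).mono (fun s hs => ⟨hs.1, hs.2.le.trans ht.2⟩)
    have hne : (𝓝[Set.Ico 0 t] t).NeBot := by
      rw [nhdsWithin_Ico_eq_nhdsLT ht0]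
      infer_instance
    obtain ⟨w, hw, hwt⟩ := hK.isClosed.mem_of_tendsto hlim hev
    apply htU
    rw [← hwt]
    refine ⟨φ.map_target (hsub hw), ?_⟩
    rw [Set.mem_preimage, φ.right_inv (hsub hw)]
    exact Metric.closedBall_subset_ball hLr hw
  exact ⟨(hall ⟨zero_le_one, le_rfl⟩).1, key 1 ⟨zero_le_one, le_rfl⟩ hall⟩

/-- Points close to the center belong to the domain of the chart, and the chart is Lipschitz at its
center. -/
theorem norm_le_mul_dist [IsManifold (𝓡 n) ∞ M] [IsRiemannianManifold (𝓡 n) M]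
    (hφ : IsNormalChart φ ξ r c) {x : M} (hx : c * dist ξ x < r) :
    x ∈ φ.source ∧ ‖φ x‖ ≤ c * dist ξ x := by
  have key (L : ℝ) (hL : dist ξ x < L) (hLr : c * L < r) : x ∈ φ.source ∧ ‖φ x‖ ≤ c * L := by
    have hL0 : 0 < L := dist_nonneg.trans_lt hL
    obtain ⟨γ, h0, h1, hγ, hlen⟩ := exists_path_of_edist_lt (I := 𝓡 n) (x := ξ) (x' := x)
      (L := ENNReal.ofReal L) (by rw [edist_dist]; exact (ENNReal.ofReal_lt_ofReal_iff hL0).2 hL)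
    have := hφ.norm_le_of_path hL0.le h0 hγ hlen.le hLr
    rwa [h1] at this
  have hev : ∀ᶠ L in 𝓝[>] dist ξ x, c * L < r := by
    have : Tendsto (fun L : ℝ => c * L) (𝓝[>] dist ξ x) (𝓝 (c * dist ξ x)) :=
      ((continuous_const.mul continuous_id).tendsto _).mono_left nhdsWithin_le_nhds
    exact this.eventually_lt_const hx
  have hev2 : ∀ᶠ L in 𝓝[>] dist ξ x, x ∈ φ.source ∧ ‖φ x‖ ≤ c * L := by
    filter_upwards [hev, self_mem_nhdsWithin] with L h1 h2
    exact key L h2 h1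
  refine ⟨hev2.exists.choose_spec.1, ?_⟩
  have hlim : Tendsto (fun L : ℝ => c * L) (𝓝[>] dist ξ x) (𝓝 (c * dist ξ x)) :=
    ((continuous_const.mul continuous_id).tendsto _).mono_left nhdsWithin_le_nhds
  exact ge_of_tendsto hlim (hev2.mono fun L h => h.2)

end IsNormalChart

/-! ### Packing estimates -/

/-- A finite set whose points have mutual distances at least `δ`. -/
def IsSeparatedFinset {M : Type*} [MetricSpace M] (T : Finset M) (δ : ℝ) : Prop :=
  ∀ x ∈ T, ∀ y ∈ T, x ≠ y → δ ≤ dist x y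

/-- Comparison of volumes: the balls of radius `δ / 2` around separated points are disjoint. -/
theorem card_le_of_isSeparatedFinset_euclidean {n : ℕ} {T : Finset (EuclideanSpace ℝ (Fin n))}
    {δ R : ℝ} (hδ : 0 < δ) (hR : 0 ≤ R) (hT : ∀ x ∈ T, ‖x‖ ≤ R) (hsep : IsSeparatedFinset T δ) :
    (T.card : ℝ) ≤ (1 + 2 * R / δ) ^ n := by
  let μ : Measure (EuclideanSpace ℝ (Fin n)) := volume
  have hdisj : (T : Set (EuclideanSpace ℝ (Fin n))).PairwiseDisjoint
      fun x => Metric.ball x (δ / 2) := fun x hx y hy hxy =>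
    Metric.ball_disjoint_ball (by have := hsep x hx y hy hxy; linarith)
  have hsub : (⋃ x ∈ T, Metric.ball x (δ / 2)) ⊆ Metric.ball 0 (R + δ / 2) := by
    refine Set.iUnion₂_subset fun x hx => Metric.ball_subset_ball' ?_
    rw [dist_zero_right]
    have := hT x hx
    linarith
  have h1 : (T.card : ℝ≥0∞) * ENNReal.ofReal ((δ / 2) ^ n) * μ (Metric.ball 0 1)
      ≤ ENNReal.ofReal ((R + δ / 2) ^ n) * μ (Metric.ball 0 1) := by
    have h2 : μ (⋃ x ∈ T, Metric.ball x (δ / 2))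
        = (T.card : ℝ≥0∞) * ENNReal.ofReal ((δ / 2) ^ n) * μ (Metric.ball 0 1) := by
      rw [measure_biUnion_finset hdisj fun x _ => measurableSet_ball]
      simp only [μ.addHaar_ball_of_pos _ (half_pos hδ), finrank_euclideanSpace, Fintype.card_fin]
      simp only [Finset.sum_const, nsmul_eq_mul, mul_assoc]
    have h3 := measure_mono (μ := μ) hsub
    rw [h2, μ.addHaar_ball_of_pos _ (by linarith : 0 < R + δ / 2), finrank_euclideanSpace,
      Fintype.card_fin] at h3
    exact h3
  have h2 : (T.card : ℝ≥0∞) * ENNReal.ofReal ((δ / 2) ^ n) ≤ ENNReal.ofReal ((R + δ / 2) ^ n) :=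
    (ENNReal.mul_le_mul_iff_left (Metric.measure_ball_pos _ _ zero_lt_one).ne'
      measure_ball_lt_top.ne).1 h1
  have h3 : (T.card : ℝ) * (δ / 2) ^ n ≤ (R + δ / 2) ^ n := by
    have := ENNReal.toReal_le_of_le_ofReal (by positivity) h2
    rwa [ENNReal.toReal_mul, ENNReal.toReal_natCast, ENNReal.toReal_ofReal (by positivity)] at this
  rw [← le_div_iff₀ (by positivity), ← div_pow] at h3
  have h4 : (R + δ / 2) / (δ / 2) = 1 + 2 * R / δ := by
    field_simp
    ring
  rwa [h4] at h3

/-- A chart carries the Euclidean packing bound to small balls of the manifold. -/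
theorem IsNormalChart.card_le {n : ℕ} {M : Type*} [MetricSpace M]
    [ChartedSpace (EuclideanSpace ℝ (Fin n)) M] [IsManifold (𝓡 n) ∞ M]
    [RiemannianBundle (fun x : M => TangentSpace (𝓡 n) x)] [IsRiemannianManifold (𝓡 n) M]
    {φ : OpenPartialHomeomorph M (EuclideanSpace ℝ (Fin n))} {ξ : M} {r : ℝ} {c : ℝ≥0}
    (hφ : IsNormalChart φ ξ r c) (hc : 1 ≤ c) {T : Finset M} {δ R : ℝ} (hδ : 0 < δ) (hR : 0 ≤ R)
    (hRr : c * R < r) (hT : ∀ x ∈ T, dist ξ x ≤ R) (hsep : IsSeparatedFinset T δ) :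
    (T.card : ℝ) ≤ (1 + 2 * c ^ 2 * (R / δ)) ^ n := by
  classical
  have hc0 : (0 : ℝ) < c := lt_of_lt_of_le zero_lt_one (by exact_mod_cast hc)
  have hT' (x) (hx : x ∈ T) : x ∈ φ.source ∧ ‖φ x‖ ≤ c * R := by
    have h1 : (c : ℝ) * dist ξ x ≤ c * R := by gcongr; exact hT x hx
    obtain ⟨h2, h3⟩ := hφ.norm_le_mul_dist (h1.trans_lt hRr)
    exact ⟨h2, h3.trans h1⟩
  have hball (x) (hx : x ∈ T) : φ x ∈ Metric.ball (0 : EuclideanSpace ℝ (Fin n)) r :=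
    mem_ball_zero_iff.2 ((hT' x hx).2.trans_lt hRr)
  have hinj : Set.InjOn φ T := fun x hx y hy h => φ.injOn (hT' x hx).1 (hT' y hy).1 h
  rw [← Finset.card_image_of_injOn hinj]
  have hsep' : IsSeparatedFinset (T.image φ) (δ / c) := by
    intro a ha b hb hab
    obtain ⟨x, hx, rfl⟩ := Finset.mem_image.1 ha
    obtain ⟨y, hy, rfl⟩ := Finset.mem_image.1 hb
    have h1 := hφ.dist_symm_le (hball x hx) (hball y hy)
    rw [φ.left_inv (hT' x hx).1, φ.left_inv (hT' y hy).1] at h1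
    rw [div_le_iff₀ hc0, mul_comm]
    exact (hsep x hx y hy fun h => hab (congrArg φ h)).trans h1
  have h := card_le_of_isSeparatedFinset_euclidean (R := c * R) (by positivity) (by positivity)
    (fun a ha => by
      obtain ⟨x, hx, rfl⟩ := Finset.mem_image.1 ha
      exact (hT' x hx).2) hsep'
  convert h using 2
  field_simp

/-- A compact metric space has a finite `δ`-separated set which is `δ`-dense. -/
theorem exists_isSeparatedFinset_dense {M : Type*} [MetricSpace M] [CompactSpace M] {δ : ℝ}
    (hδ : 0 < δ) : ∃ S : Finset M, IsSeparatedFinset S δ ∧ ∀ x, ∃ s ∈ S, dist x s < δ := by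
  classical
  obtain ⟨t, -, htfin, ht⟩ := finite_cover_balls_of_compact (isCompact_univ (X := M)) (half_pos hδ)
  lift t to Finset M using htfin
  have hbound (T : Finset M) (hT : IsSeparatedFinset T δ) : T.card ≤ t.card := by
    have hex (x : M) : ∃ z ∈ t, dist x z < δ / 2 := by
      have := ht (Set.mem_univ x)
      simpa using this
    choose z hz hzd using hex
    refine Finset.card_le_card_of_injOn z (fun x _ => hz x) fun x hx y hy hxy => ?_
    by_contra hne
    have h1 := hT x hx y hy hne
    have h2 := dist_triangle_right x y (z x)
    have h3 := hzd x
    have h4 := hzd y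
    rw [← hxy] at h4
    linarith
  let A : Set ℕ := {k | ∃ T : Finset M, IsSeparatedFinset T δ ∧ T.card = k}
  have hA : sSup A ∈ A := by
    refine Nat.sSup_mem ⟨0, ∅, fun x hx => by simp at hx, by simp⟩ ⟨t.card, ?_⟩
    rintro _ ⟨T, hT, rfl⟩
    exact hbound T hT
  obtain ⟨S, hS, hScard⟩ := hA
  refine ⟨S, hS, fun x => ?_⟩
  by_contra! hx
  have hxS : x ∉ S := fun h => by
    have := hx x h
    rw [dist_self] at this
    linarith
  have hins : IsSeparatedFinset (insert x S) δ := by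
    intro a ha b hb hab
    rcases Finset.mem_insert.1 ha with rfl | ha' <;> rcases Finset.mem_insert.1 hb with rfl | hb'
    · exact absurd rfl hab
    · exact hx b hb'
    · rw [dist_comm]
      exact hx a ha'
    · exact hS a ha' b hb' hab
  have hle : (insert x S).card ≤ sSup A := by
    refine le_csSup ⟨t.card, ?_⟩ ⟨_, hins, rfl⟩
    rintro _ ⟨T, hT, rfl⟩
    exact hbound T hT
  rw [Finset.card_insert_of_notMem hxS, hScard] at hle
  omega

/-- In a compact Riemannian manifold the number of points of a separated set is controlled by the
diameter and by local packing numbers: the points of a net are reached from one of them by chains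
of bounded length with small steps. -/
theorem card_le_of_local_packing {n : ℕ} {M : Type*} [MetricSpace M] [CompactSpace M]
    [ChartedSpace (EuclideanSpace ℝ (Fin n)) M]
    [RiemannianBundle (fun x : M => TangentSpace (𝓡 n) x)] (hM : IsRiemannianManifold (𝓡 n) M)
    {ρ δ : ℝ} (hρ : 0 < ρ) {Q Q' k : ℕ}
    (hQ : ∀ (ξ : M) (T : Finset M), (∀ x ∈ T, dist ξ x ≤ 3 * ρ) → IsSeparatedFinset T ρ →
      T.card ≤ Q)
    (hQ' : ∀ (ξ : M) (T : Finset M), (∀ x ∈ T, dist ξ x ≤ ρ) → IsSeparatedFinset T δ →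
      T.card ≤ Q')
    (hk : ∀ x y : M, dist x y < (k + 1) * ρ) {T : Finset M} (hT : IsSeparatedFinset T δ) :
    T.card ≤ Q ^ k * Q' := by
  classical
  obtain ⟨S, hS, hSd⟩ := exists_isSeparatedFinset_dense (M := M) hρ
  have hmono {A A' : Finset M} {ε : ℝ} (hA : IsSeparatedFinset A ε) (hAA' : A' ⊆ A) :
      IsSeparatedFinset A' ε := fun x hx y hy => hA x (hAA' hx) y (hAA' hy)
  have hScard : S.card ≤ Q ^ k := by
    rcases S.eq_empty_or_nonempty with rfl | ⟨x₀, hx₀⟩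
    · simp
    have key (i : ℕ) : (S.filter fun s => dist x₀ s < (i + 1) * ρ).card ≤ Q ^ i := by
      induction i with
      | zero =>
        rw [pow_zero]
        refine Finset.card_le_one.2 fun a ha b hb => ?_
        have h (a) (ha : a ∈ S.filter fun s => dist x₀ s < ((0 : ℕ) + 1) * ρ) : a = x₀ := by
          rw [Finset.mem_filter] at ha
          by_contra hne
          have := hS x₀ hx₀ a ha.1 (Ne.symm hne)
          have h2 := ha.2
          simp only [Nat.cast_zero, zero_add, one_mul] at h2
          linarith
        rw [h a ha, h b hb]
      | succ i ih =>
        have hsub : (S.filter fun s => dist x₀ s < ((i + 1 : ℕ) + 1) * ρ) ⊆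
            (S.filter fun s => dist x₀ s < (i + 1) * ρ).biUnion
              fun s' => S.filter fun s => dist s' s ≤ 3 * ρ := by
          intro s hs
          rw [Finset.mem_filter] at hs
          rw [Finset.mem_biUnion]
          rcases lt_or_ge (dist x₀ s) (2 * ρ) with hlt | hge
          · exact ⟨x₀, Finset.mem_filter.2 ⟨hx₀, by rw [dist_self]; positivity⟩,
              Finset.mem_filter.2 ⟨hs.1, by linarith⟩⟩
          · obtain ⟨z, hz1, hz2⟩ := exists_intermediate_point hM hs.2 (by positivity) hge
            obtain ⟨s', hs', hzs'⟩ := hSd z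
            refine ⟨s', Finset.mem_filter.2 ⟨hs', ?_⟩, Finset.mem_filter.2 ⟨hs.1, ?_⟩⟩
            · have := dist_triangle x₀ z s'
              push_cast at hz1
              linarith
            · have := dist_triangle_left s' s z
              linarith
        calc _ ≤ _ := Finset.card_le_card hsub
          _ ≤ (S.filter fun s => dist x₀ s < (i + 1) * ρ).card * Q :=
            Finset.card_biUnion_le_card_mul _ _ _ fun s' _ => hQ s' _
              (fun x hx => (Finset.mem_filter.1 hx).2) (hmono hS (Finset.filter_subset _ _))
          _ ≤ Q ^ i * Q := Nat.mul_le_mul_right _ ih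
          _ = Q ^ (i + 1) := (pow_succ _ _).symm
    have hall : (S.filter fun s => dist x₀ s < (k + 1) * ρ) = S :=
      Finset.filter_true_of_mem fun s _ => hk x₀ s
    rw [← hall]
    exact key k
  have hsub : T ⊆ S.biUnion fun s => T.filter fun x => dist s x ≤ ρ := by
    intro x hx
    obtain ⟨s, hs, hxs⟩ := hSd x
    rw [Finset.mem_biUnion]
    exact ⟨s, hs, Finset.mem_filter.2 ⟨hx, by rw [dist_comm]; exact hxs.le⟩⟩
  calc T.card ≤ _ := Finset.card_le_card hsub
    _ ≤ S.card * Q' := Finset.card_biUnion_le_card_mul _ _ _ fun s _ => hQ' s _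
        (fun x hx => (Finset.mem_filter.1 hx).2) (hmono hT (Finset.filter_subset _ _))
    _ ≤ Q ^ k * Q' := Nat.mul_le_mul_right _ hScard

/-- Near a point where the derivative is bounded by `A`, a map between manifolds with normal charts
expands distances to this point by a factor which depends only on `A` and on the distortion of the
charts. -/
theorem IsNormalChart.eventually_dist_le {n n' : ℕ} {M : Type*} [MetricSpace M]
    [ChartedSpace (EuclideanSpace ℝ (Fin n)) M] [IsManifold (𝓡 n) ∞ M]
    [RiemannianBundle (fun x : M => TangentSpace (𝓡 n) x)] [IsRiemannianManifold (𝓡 n) M]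
    {M' : Type*} [MetricSpace M']
    [ChartedSpace (EuclideanSpace ℝ (Fin n')) M'] [IsManifold (𝓡 n') ∞ M']
    [RiemannianBundle (fun x : M' => TangentSpace (𝓡 n') x)] [IsRiemannianManifold (𝓡 n') M']
    {h : M' → M} {η : M'} {r : ℝ} {c : ℝ≥0} (hr : 0 < r)
    {φ : OpenPartialHomeomorph M (EuclideanSpace ℝ (Fin n))} (hφ : IsNormalChart φ (h η) r c)
    {φ' : OpenPartialHomeomorph M' (EuclideanSpace ℝ (Fin n'))} (hφ' : IsNormalChart φ' η r c)
    (hh : MDifferentiableAt (𝓡 n') (𝓡 n) h η) {A : ℝ} (hA : 0 ≤ A)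
    (hAh : ∀ w : TangentSpace (𝓡 n') η, ‖mfderiv (𝓡 n') (𝓡 n) h η w‖ ≤ A * ‖w‖) :
    ∀ᶠ η' in 𝓝 η, dist (h η) (h η') ≤ c ^ 2 * (c ^ 2 * A + 1) * dist η η' := by
  obtain rfl : φ'.symm 0 = η := by rw [← hφ'.map_center, φ'.left_inv hφ'.mem_source]
  have h0 : (0 : EuclideanSpace ℝ (Fin n')) ∈ Metric.ball 0 r := Metric.mem_ball_self hr
  have h0t : (0 : EuclideanSpace ℝ (Fin n')) ∈ φ'.target := hφ'.ball_subset h0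
  set f : EuclideanSpace ℝ (Fin n') → EuclideanSpace ℝ (Fin n) := φ ∘ (h ∘ φ'.symm) with hf
  have hd1 : MDifferentiableAt (𝓡 n') (𝓡 n') φ'.symm 0 :=
    hφ'.mdifferentiable.mdifferentiableAt_symm h0t
  have hd2 : MDifferentiableAt (𝓡 n') (𝓡 n) (h ∘ φ'.symm) 0 := hh.comp 0 hd1
  have hd3 : MDifferentiableAt (𝓡 n) (𝓡 n) φ (h (φ'.symm 0)) :=
    hφ.mdifferentiable.mdifferentiableAt hφ.mem_source
  have hd : MDifferentiableAt (𝓡 n') (𝓡 n) f 0 := hd3.comp 0 hd2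
  have hdom : h (φ'.symm 0) ∈ φ.source ∩ φ ⁻¹' Metric.ball 0 r :=
    ⟨hφ.mem_source, by rw [Set.mem_preimage, hφ.map_center]; exact Metric.mem_ball_self hr⟩
  have hf0 : f 0 = 0 := hφ.map_center
  have hbound (v : EuclideanSpace ℝ (Fin n')) : ‖fderiv ℝ f 0 v‖ ≤ c ^ 2 * A * ‖v‖ := by
    have e1 : mfderiv (𝓡 n') (𝓡 n) f 0 = (mfderiv (𝓡 n) (𝓡 n) φ (h (φ'.symm 0))).comp
        ((mfderiv (𝓡 n') (𝓡 n) h (φ'.symm 0)).comp (mfderiv (𝓡 n') (𝓡 n') φ'.symm 0)) := by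
      rw [← mfderiv_comp 0 hh hd1]
      exact mfderiv_comp 0 hd3 hd2
    let v' : TangentSpace (𝓡 n') (0 : EuclideanSpace ℝ (Fin n')) := v
    have hv' : ‖v'‖ = ‖v‖ := norm_tangentSpace_vectorSpace
    have e2 : ‖mfderiv (𝓡 n') (𝓡 n) f 0 v'‖ = ‖fderiv ℝ f 0 v‖ := by
      rw [norm_tangentSpace_vectorSpace]
      simp only [mfderiv_eq_fderiv]
      rfl
    have e3 := hφ.norm_mfderiv_le hdom ((mfderiv (𝓡 n') (𝓡 n) h (φ'.symm 0))
      (mfderiv (𝓡 n') (𝓡 n') φ'.symm 0 v'))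
    have e4 := hAh (mfderiv (𝓡 n') (𝓡 n') φ'.symm 0 v')
    have e5 := hφ'.norm_mfderiv_symm_le 0 h0 v'
    rw [← e2, ← hv']
    calc ‖mfderiv (𝓡 n') (𝓡 n) f 0 v'‖
        ≤ c * ‖(mfderiv (𝓡 n') (𝓡 n) h (φ'.symm 0))
          (mfderiv (𝓡 n') (𝓡 n') φ'.symm 0 v')‖ := by rw [e1]; exact e3
      _ ≤ c * (A * (c * ‖v'‖)) := by
          gcongr
          exact e4.trans (by gcongr)
      _ = c ^ 2 * A * ‖v'‖ := by ring
  have hfd : HasFDerivAt f (fderiv ℝ f 0) 0 := by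
    rw [mdifferentiableAt_iff_differentiableAt] at hd
    exact hd.hasFDerivAt
  have hlin : ∀ᶠ w in 𝓝 (0 : EuclideanSpace ℝ (Fin n')), ‖f w‖ ≤ (c ^ 2 * A + 1) * ‖w‖ := by
    have := (hasFDerivAt_iff_isLittleO_nhds_zero.1 hfd).bound zero_lt_one
    filter_upwards [this] with w hw
    rw [zero_add, hf0, sub_zero, one_mul] at hw
    have h1 := norm_le_norm_add_norm_sub' (f w) (fderiv ℝ f 0 w)
    have h2 := hbound w
    linarith
  have hsmall : ∀ᶠ w in 𝓝 (0 : EuclideanSpace ℝ (Fin n')), f w ∈ Metric.ball 0 r ∧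
      h (φ'.symm w) ∈ φ.source := by
    have hc1 : ContinuousAt f 0 := hd.continuousAt
    have hc2 : ContinuousAt (h ∘ φ'.symm) 0 := hd2.continuousAt
    exact (hc1.eventually_mem (by rw [hf0]; exact Metric.ball_mem_nhds _ hr)).and
      (hc2.eventually_mem (φ.open_source.mem_nhds hφ.mem_source))
  have htend : Tendsto φ' (𝓝 (φ'.symm 0)) (𝓝 0) := by
    have := φ'.continuousAt hφ'.mem_source
    rwa [ContinuousAt, hφ'.map_center] at this
  have hnear : ∀ᶠ η' in 𝓝 (φ'.symm 0), c * dist (φ'.symm 0) η' < r := by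
    have : Tendsto (fun η' => c * dist (φ'.symm 0) η') (𝓝 (φ'.symm 0)) (𝓝 (c * 0)) := by
      rw [← dist_self (φ'.symm 0)]
      exact (continuous_const.mul (continuous_const.dist continuous_id)).tendsto _
    exact this.eventually_lt_const (by simpa using hr)
  filter_upwards [htend.eventually hlin, htend.eventually hsmall, hnear] with η' h1 h2 h3
  obtain ⟨h4, h5⟩ := hφ'.norm_le_mul_dist h3
  rw [φ'.left_inv h4] at h2
  have e1 : f (φ' η') = φ (h η') := by simp [hf, φ'.left_inv h4]
  rw [e1] at h1 h2
  have h6 := hφ.dist_symm_le (Metric.mem_ball_self hr) h2.1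
  rw [φ.left_inv h2.2, ← hφ.map_center, φ.left_inv hφ.mem_source, hφ.map_center,
    dist_zero_left] at h6
  calc dist (h (φ'.symm 0)) (h η') ≤ c * ‖φ (h η')‖ := h6
    _ ≤ c * ((c ^ 2 * A + 1) * (c * dist (φ'.symm 0) η')) := by
        gcongr
        exact h1.trans (by gcongr)
    _ = c ^ 2 * (c ^ 2 * A + 1) * dist (φ'.symm 0) η' := by ring

/-! ### Uniform geometry of the fibers -/

namespace RiemannianFiberBundle

variable {B : Type u} [MeasurableSpace B] {E : RiemannianFiberBundle.{u, v} B}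

/-- The distortion of the Riemannian metric in the reference charts. -/
noncomputable def ReferenceCharts.distortion (R : E.ReferenceCharts) : ℝ≥0 :=
  NNReal.sqrt (max R.C 1).toNNReal

namespace ReferenceCharts

variable (R : E.ReferenceCharts)

theorem distortion_sq : (R.distortion : ℝ) ^ 2 = max R.C 1 := by
  rw [distortion, ← NNReal.coe_pow, NNReal.sq_sqrt,
    Real.coe_toNNReal _ (zero_le_one.trans (le_max_right _ _))]

theorem one_le_distortion : 1 ≤ R.distortion := by
  have h := R.distortion_sq
  have h1 : (1 : ℝ) ≤ (R.distortion : ℝ) ^ 2 := h ▸ le_max_right _ _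
  have h2 : (1 : ℝ) ≤ R.distortion := by
    by_contra! hlt
    nlinarith [R.distortion.coe_nonneg]
  exact_mod_cast h2

theorem isNormalChart (y : B) (ξ : E.Fib y) :
    IsNormalChart (R.chart y ξ) ξ R.r R.distortion where
  mem_atlas := R.mem_atlas y ξ
  mem_source := R.mem_source y ξ
  map_center := R.map_center y ξ
  ball_subset := R.ball_subset y ξ
  norm_mfderiv_symm_le u hu v := by
    let v' : EuclideanSpace ℝ (Fin (E.dim y)) := v
    have hv : ‖v‖ = ‖v'‖ := norm_tangentSpace_vectorSpace
    have h := R.upper_bound y ξ 0 (by norm_num) u hu v' v'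
    rw [norm_iteratedFDeriv_zero] at h
    have h2 : E.gram y (R.chart y ξ) u v' v'
        = ‖mfderiv (𝓡 (E.dim y)) (𝓡 (E.dim y)) (R.chart y ξ).symm u v‖ ^ 2 :=
      real_inner_self_eq_norm_sq _
    rw [h2, Real.norm_eq_abs, abs_of_nonneg (by positivity), ← hv] at h
    refine abs_le_of_sq_le_sq' ?_ (by positivity) |>.2
    rw [mul_pow, distortion_sq]
    calc _ ≤ _ := h
      _ = R.C * ‖v‖ ^ 2 := by ring
      _ ≤ max R.C 1 * ‖v‖ ^ 2 := by gcongr; exact le_max_left _ _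
  norm_le_mfderiv_symm u hu v := by
    let v' : EuclideanSpace ℝ (Fin (E.dim y)) := v
    have hv : ‖v‖ = ‖v'‖ := norm_tangentSpace_vectorSpace
    have h := R.lower_bound y ξ u hu v'
    have h2 : E.gram y (R.chart y ξ) u v' v'
        = ‖mfderiv (𝓡 (E.dim y)) (𝓡 (E.dim y)) (R.chart y ξ).symm u v‖ ^ 2 :=
      real_inner_self_eq_norm_sq _
    rw [h2, ← hv] at h
    refine abs_le_of_sq_le_sq' ?_ (by positivity) |>.2
    rw [mul_pow, distortion_sq]
    exact h.trans (by gcongr; exact le_max_left _ _)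

theorem card_le {d : ℕ} (hd : ∀ y, E.dim y ≤ d) {y : B} {ξ : E.Fib y} {T : Finset (E.Fib y)}
    {δ s : ℝ} (hδ : 0 < δ) (hs : 0 ≤ s) (hsr : R.distortion * s < R.r)
    (hT : ∀ x ∈ T, dist ξ x ≤ s) (hsep : IsSeparatedFinset T δ) :
    (T.card : ℝ) ≤ (1 + 2 * (R.distortion : ℝ) ^ 2 * (s / δ)) ^ d := by
  refine ((R.isNormalChart y ξ).card_le R.one_le_distortion hδ hs hsr hT hsep).trans ?_
  exact pow_le_pow_right₀ (le_add_of_nonneg_right (by positivity)) (hd y)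

/-- Separated sets of the fibers have uniformly bounded cardinality. -/
theorem exists_card_le (R : E.ReferenceCharts) {d : ℕ} (hd : ∀ y, E.dim y ≤ d) {D : ℝ}
    (hD : ∀ y, Metric.diam (Set.univ : Set (E.Fib y)) ≤ D) {δ : ℝ} (hδ : 0 < δ) :
    ∃ N : ℕ, ∀ (y : B) (T : Finset (E.Fib y)), IsSeparatedFinset T δ → T.card ≤ N := by
  have hc : (0 : ℝ) < R.distortion :=
    lt_of_lt_of_le zero_lt_one (by exact_mod_cast R.one_le_distortion)
  set ρ : ℝ := R.r / (4 * R.distortion) with hρ_def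
  have hρ : 0 < ρ := div_pos R.r_pos (by positivity)
  have hρr : R.distortion * (3 * ρ) < R.r := by
    have : R.distortion * (3 * ρ) = 3 / 4 * R.r := by
      rw [hρ_def]
      field_simp
    linarith [R.r_pos]
  have hρr' : R.distortion * ρ < R.r := by
    refine lt_of_le_of_lt ?_ hρr
    gcongr
    linarith
  obtain ⟨k, hk⟩ := exists_nat_gt (D / ρ)
  have hkD : D < (k + 1) * ρ := by
    rw [div_lt_iff₀ hρ] at hk
    linarith
  refine ⟨⌊(1 + 2 * (R.distortion : ℝ) ^ 2 * (3 * ρ / ρ)) ^ d⌋₊ ^ k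
    * ⌊(1 + 2 * (R.distortion : ℝ) ^ 2 * (ρ / δ)) ^ d⌋₊, fun y T hT => ?_⟩
  refine card_le_of_local_packing (E.isRiemannianManifold y) hρ (fun ξ T hT1 hT2 => ?_)
    (fun ξ T hT1 hT2 => ?_) (fun x x' => ?_) hT
  · exact Nat.le_floor (R.card_le hd hρ (by positivity) hρr hT1 hT2)
  · exact Nat.le_floor (R.card_le hd hδ hρ.le hρr' hT1 hT2)
  · exact ((Metric.dist_le_diam_of_mem isCompact_univ.isBounded (Set.mem_univ x)
      (Set.mem_univ x')).trans (hD y)).trans_lt hkD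

end ReferenceCharts

end RiemannianFiberBundle

/-! ### Measurable classes of fibers with comparable metrics -/

/-- The norm of the derivative of a `C^1` map from an open subset of a Euclidean space to a
Riemannian manifold depends continuously on the point and on the tangent vector. -/
theorem continuousOn_norm_mfderiv {n n' : ℕ} {M : Type*} [MetricSpace M]
    [ChartedSpace (EuclideanSpace ℝ (Fin n)) M] [IsManifold (𝓡 n) ∞ M]
    [RiemannianBundle (fun x : M => TangentSpace (𝓡 n) x)]
    [IsContMDiffRiemannianBundle (𝓡 n) 2 (EuclideanSpace ℝ (Fin n))
      (fun x : M => TangentSpace (𝓡 n) x)]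
    {h : EuclideanSpace ℝ (Fin n') → M} {U : Set (EuclideanSpace ℝ (Fin n'))} (hU : IsOpen U)
    (hh : ContMDiffOn (𝓡 n') (𝓡 n) 1 h U) :
    ContinuousOn (fun p : EuclideanSpace ℝ (Fin n') × EuclideanSpace ℝ (Fin n') =>
      ‖mfderiv (𝓡 n') (𝓡 n) h p.1 p.2‖) (U ×ˢ Set.univ) := by
  have : IsContinuousRiemannianBundle (EuclideanSpace ℝ (Fin n))
      (fun x : M => TangentSpace (𝓡 n) x) := by
    obtain ⟨G, hG, hG'⟩ := IsContMDiffRiemannianBundle.exists_contMDiff (IB := 𝓡 n) (n := 2)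
      (F := EuclideanSpace ℝ (Fin n)) (E := fun x : M => TangentSpace (𝓡 n) x)
    exact ⟨G, hG.continuous, hG'⟩
  have h1 := hh.continuousOn_tangentMapWithin le_rfl hU.uniqueMDiffOn
  have h2 : Continuous ((tangentBundleModelSpaceHomeomorph (𝓡 n')).symm) :=
    (tangentBundleModelSpaceHomeomorph (𝓡 n')).symm.continuous
  have h3 : ContinuousOn (fun p : EuclideanSpace ℝ (Fin n') × EuclideanSpace ℝ (Fin n') =>
      (⟨h p.1, mfderiv (𝓡 n') (𝓡 n) h p.1 p.2⟩ :
        TotalSpace (EuclideanSpace ℝ (Fin n)) (fun x : M => TangentSpace (𝓡 n) x)))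
      (U ×ˢ Set.univ) := by
    have h4 := h1.comp (f := fun p : EuclideanSpace ℝ (Fin n') × EuclideanSpace ℝ (Fin n') =>
      (tangentBundleModelSpaceHomeomorph (𝓡 n')).symm p) (s := U ×ˢ Set.univ)
      h2.continuousOn (fun p hp => by
        rw [tangentBundleModelSpaceHomeomorph_coe_symm]
        exact hp.1)
    refine h4.congr fun p hp => ?_
    rw [Function.comp_apply, tangentBundleModelSpaceHomeomorph_coe_symm]
    simp only [tangentMapWithin]
    rw [mfderivWithin_of_isOpen hU]
    · rfl
    · exact hp.1
  have h5 := (ContinuousOn.inner_bundle h3 h3).sqrt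
  refine h5.congr fun p _ => ?_
  exact norm_eq_sqrt_real_inner _

namespace RiemannianFiberBundle

variable {B : Type u} [MeasurableSpace B] (E : RiemannianFiberBundle.{u, v} B)

/-- The Riemannian norm of the fiber over `y`, read in the chart of the model at `a`: a function of
a point and of a tangent vector at this point. -/
noncomputable def chartNorm (i : ℕ) (a : E.Model i) (y : {y // E.idx y = i})
    (p : EuclideanSpace ℝ (Fin (E.modelDim i)) × EuclideanSpace ℝ (Fin (E.modelDim i))) : ℝ :=
  ‖mfderiv (𝓡 (E.modelDim i)) (𝓡 (E.dim y.1)) ((E.triv i y.1 y.2).symm ∘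
    (chartAt (EuclideanSpace ℝ (Fin (E.modelDim i))) a).symm) p.1 p.2‖

variable {E} {i : ℕ} {a : E.Model i}

theorem chartNorm_eq (y : {y // E.idx y = i}) {u : EuclideanSpace ℝ (Fin (E.modelDim i))}
    (hu : u ∈ (chartAt (EuclideanSpace ℝ (Fin (E.modelDim i))) a).target)
    (w : EuclideanSpace ℝ (Fin (E.modelDim i))) :
    E.chartNorm i a y (u, w) = ‖mfderiv (𝓡 (E.modelDim i)) (𝓡 (E.dim y.1))
      (E.triv i y.1 y.2).symm ((chartAt (EuclideanSpace ℝ (Fin (E.modelDim i))) a).symm u)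
      (mfderiv (𝓡 (E.modelDim i)) (𝓡 (E.modelDim i))
        (chartAt (EuclideanSpace ℝ (Fin (E.modelDim i))) a).symm u w)‖ := by
  have hd := (mdifferentiable_chart (I := 𝓡 (E.modelDim i)) a).mdifferentiableAt_symm hu
  have hd' : MDifferentiableAt (𝓡 (E.modelDim i)) (𝓡 (E.dim y.1)) (E.triv i y.1 y.2).symm
      ((chartAt (EuclideanSpace ℝ (Fin (E.modelDim i))) a).symm u) :=
    (E.triv i y.1 y.2).symm.contMDiff.mdifferentiable (by simp) _
  rw [chartNorm, mfderiv_comp u hd' hd]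
  rfl

theorem measurable_chartNorm {u : EuclideanSpace ℝ (Fin (E.modelDim i))}
    (hu : u ∈ (chartAt (EuclideanSpace ℝ (Fin (E.modelDim i))) a).target)
    (w : EuclideanSpace ℝ (Fin (E.modelDim i))) :
    Measurable fun y => E.chartNorm i a y (u, w) := by
  simp_rw [fun y => chartNorm_eq y hu w]
  exact E.measurable_metric i _ _

theorem continuousOn_chartNorm (y : {y // E.idx y = i}) :
    ContinuousOn (E.chartNorm i a y)
      ((chartAt (EuclideanSpace ℝ (Fin (E.modelDim i))) a).target ×ˢ Set.univ) := by
  refine continuousOn_norm_mfderiv (chartAt _ a).open_target ?_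
  refine ContMDiff.comp_contMDiffOn
    ((E.triv i y.1 y.2).symm.contMDiff.of_le (by simp)) ?_
  exact (contMDiffOn_chart_symm (n := ∞) (I := 𝓡 (E.modelDim i)) (x := a)).of_le (by simp)

theorem chartNorm_pos (y : {y // E.idx y = i}) {u : EuclideanSpace ℝ (Fin (E.modelDim i))}
    (hu : u ∈ (chartAt (EuclideanSpace ℝ (Fin (E.modelDim i))) a).target)
    {w : EuclideanSpace ℝ (Fin (E.modelDim i))} (hw : w ≠ 0) : 0 < E.chartNorm i a y (u, w) := by
  rw [chartNorm_eq y hu, norm_pos_iff]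
  intro h0
  have h1 := ((E.triv i y.1 y.2).symm.mfderivToContinuousLinearEquiv (by simp)
    ((chartAt (EuclideanSpace ℝ (Fin (E.modelDim i))) a).symm u)).injective
    (h0.trans (map_zero _).symm)
  have h2 := (mdifferentiable_chart (I := 𝓡 (E.modelDim i)) a).symm.mfderiv_injective hu
    (h1.trans (map_zero _).symm)
  exact hw h2

theorem chartNorm_smul (y : {y // E.idx y = i}) (u w : EuclideanSpace ℝ (Fin (E.modelDim i)))
    (t : ℝ) : E.chartNorm i a y (u, t • w) = |t| * E.chartNorm i a y (u, w) := by
  rw [chartNorm, chartNorm, ← Real.norm_eq_abs, ← norm_smul]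
  congr 1
  exact map_smul (mfderiv (𝓡 (E.modelDim i)) (𝓡 (E.dim y.1)) ((E.triv i y.1 y.2).symm ∘
    (chartAt (EuclideanSpace ℝ (Fin (E.modelDim i))) a).symm) u) t w

end RiemannianFiberBundle

namespace RiemannianFiberBundle

variable {B : Type u} [MeasurableSpace B] {E : RiemannianFiberBundle.{u, v} B}

/-- Two fibers are identified with the same model, and the two metrics that they induce on the model
differ by at most the factor `2`. -/
def MetricClose (E : RiemannianFiberBundle.{u, v} B) (y y₀ : B) : Prop :=
  ∃ (i : ℕ) (h : E.idx y = i) (h₀ : E.idx y₀ = i), ∀ (η : E.Model i)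
    (w : TangentSpace (𝓡 (E.modelDim i)) η),
    ‖mfderiv (𝓡 (E.modelDim i)) (𝓡 (E.dim y)) (E.triv i y h).symm η w‖
      ≤ 2 * ‖mfderiv (𝓡 (E.modelDim i)) (𝓡 (E.dim y₀)) (E.triv i y₀ h₀).symm η w‖ ∧
    ‖mfderiv (𝓡 (E.modelDim i)) (𝓡 (E.dim y₀)) (E.triv i y₀ h₀).symm η w‖
      ≤ 2 * ‖mfderiv (𝓡 (E.modelDim i)) (𝓡 (E.dim y)) (E.triv i y h).symm η w‖

/-- Finitely many compact balls in charts which cover a model manifold. -/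
theorem exists_chart_cover (E : RiemannianFiberBundle.{u, v} B) (i : ℕ) :
    ∃ (A : Finset (E.Model i)) (ε : E.Model i → ℝ),
      (∀ a, Metric.closedBall (chartAt (EuclideanSpace ℝ (Fin (E.modelDim i))) a a) (ε a)
        ⊆ (chartAt (EuclideanSpace ℝ (Fin (E.modelDim i))) a).target) ∧
      ∀ η : E.Model i, ∃ a ∈ A, ∃ u ∈ Metric.closedBall
        (chartAt (EuclideanSpace ℝ (Fin (E.modelDim i))) a a) (ε a),
        (chartAt (EuclideanSpace ℝ (Fin (E.modelDim i))) a).symm u = η := by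
  have h1 (a : E.Model i) : ∃ ε > 0,
      Metric.closedBall (chartAt (EuclideanSpace ℝ (Fin (E.modelDim i))) a a) ε
        ⊆ (chartAt (EuclideanSpace ℝ (Fin (E.modelDim i))) a).target :=
    Metric.nhds_basis_closedBall.mem_iff.1
      ((chartAt _ a).open_target.mem_nhds (mem_chart_target _ a))
  choose ε hε hball using h1
  have hnhds (a : E.Model i) : (chartAt (EuclideanSpace ℝ (Fin (E.modelDim i))) a).source ∩
      chartAt (EuclideanSpace ℝ (Fin (E.modelDim i))) a ⁻¹'
        Metric.closedBall (chartAt (EuclideanSpace ℝ (Fin (E.modelDim i))) a a) (ε a) ∈ 𝓝 a :=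
    Filter.inter_mem (chart_source_mem_nhds _ a)
      (((chartAt _ a).continuousAt (mem_chart_source _ a)).preimage_mem_nhds
        (Metric.closedBall_mem_nhds _ (hε a)))
  obtain ⟨A, -, hA⟩ := isCompact_univ.elim_nhds_subcover _ fun a _ => hnhds a
  refine ⟨A, ε, hball, fun η => ?_⟩
  obtain ⟨a, ha, hη⟩ := Set.mem_iUnion₂.1 (hA (Set.mem_univ η))
  exact ⟨a, ha, _, hη.2, (chartAt _ a).left_inv hη.1⟩

/-- The comparison of two metrics can be checked in finitely many charts. -/
theorem metricClose_of_chartNorm {i : ℕ} {A : Finset (E.Model i)} {ε : E.Model i → ℝ}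
    (hball : ∀ a, Metric.closedBall (chartAt (EuclideanSpace ℝ (Fin (E.modelDim i))) a a) (ε a)
        ⊆ (chartAt (EuclideanSpace ℝ (Fin (E.modelDim i))) a).target)
    (hA : ∀ η : E.Model i, ∃ a ∈ A, ∃ u ∈ Metric.closedBall
        (chartAt (EuclideanSpace ℝ (Fin (E.modelDim i))) a a) (ε a),
        (chartAt (EuclideanSpace ℝ (Fin (E.modelDim i))) a).symm u = η)
    {y y₀ : {y // E.idx y = i}}
    (h : ∀ a ∈ A, ∀ u ∈ Metric.closedBall
        (chartAt (EuclideanSpace ℝ (Fin (E.modelDim i))) a a) (ε a), ∀ w,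
      E.chartNorm i a y (u, w) ≤ 2 * E.chartNorm i a y₀ (u, w) ∧
      E.chartNorm i a y₀ (u, w) ≤ 2 * E.chartNorm i a y (u, w)) :
    E.MetricClose y y₀ := by
  refine ⟨i, y.2, y₀.2, fun η w => ?_⟩
  obtain ⟨a, ha, u, hu, rfl⟩ := hA η
  obtain ⟨w', rfl⟩ := (mdifferentiable_chart (I := 𝓡 (E.modelDim i)) a).symm.mfderiv_surjective
    (hball a hu) w
  let w'' : EuclideanSpace ℝ (Fin (E.modelDim i)) := w'
  have := h a ha u hu w''
  rw [chartNorm_eq y (hball a hu) w'', chartNorm_eq y₀ (hball a hu) w''] at this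
  exact this

theorem MetricClose.chartNorm_le {i : ℕ} {y y₀ : {y // E.idx y = i}} (h : E.MetricClose y y₀)
    (a : E.Model i) {u : EuclideanSpace ℝ (Fin (E.modelDim i))}
    (hu : u ∈ (chartAt (EuclideanSpace ℝ (Fin (E.modelDim i))) a).target)
    (w : EuclideanSpace ℝ (Fin (E.modelDim i))) :
    E.chartNorm i a y (u, w) ≤ 2 * E.chartNorm i a y₀ (u, w) ∧
      E.chartNorm i a y₀ (u, w) ≤ 2 * E.chartNorm i a y (u, w) := by
  obtain ⟨j, hj, hj₀, hle⟩ := h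
  obtain rfl : i = j := y.2.symm.trans hj
  rw [chartNorm_eq y hu, chartNorm_eq y₀ hu]
  exact hle _ _

theorem measurableSet_metricClose (y₀ : B) : MeasurableSet {y | E.MetricClose y y₀} := by
  set i := E.idx y₀ with hi
  let z₀ : {y // E.idx y = i} := ⟨y₀, rfl⟩
  obtain ⟨A, ε, hball, hA⟩ := E.exists_chart_cover i
  -- by continuity it is enough to compare the metrics on a countable dense set
  have hdense (a : E.Model i) := (TopologicalSpace.IsSeparable.of_separableSpace
    ((chartAt (EuclideanSpace ℝ (Fin (E.modelDim i))) a).target ×ˢ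
      (Set.univ : Set (EuclideanSpace ℝ (Fin (E.modelDim i)))))).exists_countable_dense_subset
  choose Q hQW hQc hQd using hdense
  have himage : {y | E.MetricClose y y₀} = Subtype.val '' {y : {y // E.idx y = i} |
      ∀ a ∈ A, ∀ p ∈ Q a, E.chartNorm i a y p ≤ 2 * E.chartNorm i a z₀ p ∧
        E.chartNorm i a z₀ p ≤ 2 * E.chartNorm i a y p} := by
    ext y
    constructor
    · intro h
      have hy : E.idx y = i := by
        obtain ⟨j, hj, hj₀, -⟩ := id h
        rw [hj, hi, hj₀]
      exact ⟨⟨y, hy⟩, fun a _ p hp =>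
        MetricClose.chartNorm_le (y := ⟨y, hy⟩) (y₀ := z₀) h a (hQW a hp).1 p.2, rfl⟩
    · rintro ⟨z, hz, rfl⟩
      refine metricClose_of_chartNorm (y₀ := z₀) hball hA fun a ha u hu w => ?_
      have hmem : (u, w) ∈ (chartAt (EuclideanSpace ℝ (Fin (E.modelDim i))) a).target ×ˢ
          (Set.univ : Set (EuclideanSpace ℝ (Fin (E.modelDim i)))) := ⟨hball a hu, Set.mem_univ _⟩
      have hc (z) := (continuousOn_chartNorm (E := E) (a := a) z (u, w) hmem).mono (hQW a)
      exact ⟨ContinuousWithinAt.closure_le (hQd a hmem) (hc z)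
          (continuousWithinAt_const.mul (hc z₀)) fun p hp => (hz a ha p hp).1,
        ContinuousWithinAt.closure_le (hQd a hmem) (hc z₀)
          (continuousWithinAt_const.mul (hc z)) fun p hp => (hz a ha p hp).2⟩
  rw [himage]
  refine MeasurableSet.subtype_image (E.measurable_idx (measurableSet_singleton i)) ?_
  have hset : {y : {y // E.idx y = i} |
      ∀ a ∈ A, ∀ p ∈ Q a, E.chartNorm i a y p ≤ 2 * E.chartNorm i a z₀ p ∧
        E.chartNorm i a z₀ p ≤ 2 * E.chartNorm i a y p}
      = ⋂ a ∈ A, ⋂ p ∈ Q a, ({y | E.chartNorm i a y p ≤ 2 * E.chartNorm i a z₀ p} ∩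
        {y | E.chartNorm i a z₀ p ≤ 2 * E.chartNorm i a y p}) := by
    ext y
    simp
  rw [hset]
  refine Finset.measurableSet_biInter _ fun a _ => MeasurableSet.biInter (hQc a) fun p hp => ?_
  have hm : Measurable fun y => E.chartNorm i a y p := measurable_chartNorm (hQW a hp).1 p.2
  exact (measurableSet_le hm measurable_const).inter
    (measurableSet_le measurable_const (hm.const_mul 2))

/-- The metrics on a model manifold form a separable space; so countably many of them approximate
all the others up to the factor `2`. -/
theorem exists_countable_metricClose_of_idx (E : RiemannianFiberBundle.{u, v} B) (i : ℕ) :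
    ∃ S : Set B, S.Countable ∧ ∀ y, E.idx y = i → ∃ y₀ ∈ S, E.MetricClose y y₀ := by
  obtain ⟨A, ε, hball, hA⟩ := E.exists_chart_cover i
  let Kc : E.Model i → Set (EuclideanSpace ℝ (Fin (E.modelDim i)) ×
      EuclideanSpace ℝ (Fin (E.modelDim i))) := fun a =>
    Metric.closedBall (chartAt (EuclideanSpace ℝ (Fin (E.modelDim i))) a a) (ε a) ×ˢ
      Metric.sphere 0 1
  have hKc (a) : IsCompact (Kc a) := (isCompact_closedBall _ _).prod (isCompact_sphere _ _)
  have hcomp (a) : CompactSpace (Kc a) := isCompact_iff_compactSpace.1 (hKc a)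
  let Γ : {y // E.idx y = i} → ∀ a : A, C(Kc a, ℝ) := fun y a =>
    ⟨fun p => E.chartNorm i a y p, ((continuousOn_chartNorm y).mono
      (Set.prod_mono (hball a) (Set.subset_univ _))).domRestrict⟩
  let O : {y // E.idx y = i} → Set (∀ a : A, C(Kc a, ℝ)) := fun y₀ =>
    {G | ∀ a, (∀ p, 0 < (Γ y₀ a + Γ y₀ a - G a) p) ∧ ∀ p, 0 < (G a + G a - Γ y₀ a) p}
  have hpos (y) (a : A) (p : Kc a) : 0 < Γ y a p := by
    refine chartNorm_pos y (hball a p.2.1) (w := p.1.2) fun h0 => ?_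
    have := p.2.2
    rw [h0] at this
    simp at this
  have hopen (K : Type _) [TopologicalSpace K] [CompactSpace K] :
      IsOpen {G : C(K, ℝ) | ∀ p, 0 < G p} := by
    have := ContinuousMap.isOpen_setOfPred_mapsTo (Y := ℝ) (isCompact_univ (X := K))
      (isOpen_Ioi (a := (0 : ℝ)))
    simpa [Set.MapsTo] using this
  have hO (y₀) : IsOpen (O y₀) := by
    have : O y₀ = ⋂ a : A, ((fun G : ∀ a : A, C(Kc a, ℝ) => Γ y₀ a + Γ y₀ a - G a) ⁻¹'
        {G | ∀ p, 0 < G p} ∩ (fun G : ∀ a : A, C(Kc a, ℝ) => G a + G a - Γ y₀ a) ⁻¹'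
        {G | ∀ p, 0 < G p}) := by
      ext G
      simp [O]
    rw [this]
    refine isOpen_iInter_of_finite fun a => ?_
    exact ((hopen _).preimage (continuous_const.sub (continuous_apply a))).inter
      ((hopen _).preimage (((continuous_apply a).add (continuous_apply a)).sub continuous_const))
  obtain ⟨T, hT, hTO⟩ := TopologicalSpace.isOpen_iUnion_countable O hO
  refine ⟨Subtype.val '' T, hT.image _, fun y hy => ?_⟩
  let z : {y // E.idx y = i} := ⟨y, hy⟩
  have hz : Γ z ∈ ⋃ y₀, O y₀ := by
    refine Set.mem_iUnion.2 ⟨z, fun a => ⟨fun p => ?_, fun p => ?_⟩⟩ <;>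
    · have := hpos z a p
      simp only [ContinuousMap.sub_apply, ContinuousMap.add_apply]
      linarith
  rw [← hTO] at hz
  obtain ⟨z₀, hz₀T, hz₀⟩ := Set.mem_iUnion₂.1 hz
  refine ⟨z₀, ⟨z₀, hz₀T, rfl⟩, ?_⟩
  refine metricClose_of_chartNorm (y := z) hball hA fun a ha u hu w => ?_
  rcases eq_or_ne w 0 with rfl | hw
  · have h0 (z) : E.chartNorm i a z (u, 0) = 0 := by
      have := chartNorm_smul (E := E) (a := a) z u 0 0
      simpa using this
    simp [h0]
  -- the comparison on unit vectors extends by homogeneity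
  have hnorm : 0 < ‖w‖ := norm_pos_iff.2 hw
  have hw' : w = ‖w‖ • (‖w‖⁻¹ • w) := by rw [smul_smul, mul_inv_cancel₀ hnorm.ne', one_smul]
  let p : Kc a := ⟨(u, ‖w‖⁻¹ • w), hu, by simp [norm_smul, hnorm.ne']⟩
  have h1 := (hz₀ ⟨a, ha⟩).1 p
  have h2 := (hz₀ ⟨a, ha⟩).2 p
  simp only [ContinuousMap.sub_apply, ContinuousMap.add_apply] at h1 h2
  have h3 : E.chartNorm i a z (u, ‖w‖⁻¹ • w)
      < E.chartNorm i a z₀ (u, ‖w‖⁻¹ • w) + E.chartNorm i a z₀ (u, ‖w‖⁻¹ • w) := sub_pos.1 h1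
  have h4 : E.chartNorm i a z₀ (u, ‖w‖⁻¹ • w)
      < E.chartNorm i a z (u, ‖w‖⁻¹ • w) + E.chartNorm i a z (u, ‖w‖⁻¹ • w) := sub_pos.1 h2
  have hs (z) : E.chartNorm i a z (u, w) = ‖w‖ * E.chartNorm i a z (u, ‖w‖⁻¹ • w) := by
    conv_lhs => rw [hw', chartNorm_smul, abs_of_pos hnorm]
  rw [hs z, hs z₀]
  constructor <;> nlinarith

/-- A countable measurable partition of the base into classes of fibers with comparable metrics. -/
theorem exists_measurable_metricClose (E : RiemannianFiberBundle.{u, v} B) [Nonempty B] :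
    ∃ (cls : B → ℕ) (rep : ℕ → B), Measurable cls ∧ ∀ y, E.MetricClose y (rep (cls y)) := by
  classical
  choose S hSc hS using E.exists_countable_metricClose_of_idx
  have hne : (⋃ i, S i).Nonempty := by
    obtain ⟨y⟩ := ‹Nonempty B›
    obtain ⟨y₀, hy₀, -⟩ := hS _ y rfl
    exact ⟨y₀, Set.mem_iUnion.2 ⟨_, hy₀⟩⟩
  obtain ⟨rep, hrep⟩ := (Set.countable_iUnion hSc).exists_eq_range hne
  have hex (y : B) : ∃ k, E.MetricClose y (rep k) := by
    obtain ⟨y₀, hy₀, h⟩ := hS _ y rfl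
    obtain ⟨k, rfl⟩ : y₀ ∈ Set.range rep := hrep ▸ Set.mem_iUnion.2 ⟨_, hy₀⟩
    exact ⟨k, h⟩
  refine ⟨fun y => Nat.find (hex y), rep, ?_, fun y => Nat.find_spec (hex y)⟩
  exact measurable_find hex fun k => measurableSet_metricClose (rep k)

/-- Close metrics: the fibers are related by a `2`-bi-Lipschitz homeomorphism. -/
theorem MetricClose.lipschitzWith {i : ℕ} {y y₀ : B} (hy : E.idx y = i) (hy₀ : E.idx y₀ = i)
    (h : E.MetricClose y y₀) :
    LipschitzWith 2 (fun ξ => (E.triv i y₀ hy₀).symm (E.triv i y hy ξ)) ∧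
      LipschitzWith 2 (fun ξ => (E.triv i y hy).symm (E.triv i y₀ hy₀ ξ)) := by
  obtain ⟨j, hj, hj₀, hle⟩ := h
  obtain rfl : i = j := hy.symm.trans hj
  have key {y y₀ : B} (hy : E.idx y = i) (hy₀ : E.idx y₀ = i)
      (h : ∀ (η : E.Model i) (w : TangentSpace (𝓡 (E.modelDim i)) η),
        ‖mfderiv (𝓡 (E.modelDim i)) (𝓡 (E.dim y₀)) (E.triv i y₀ hy₀).symm η w‖
          ≤ 2 * ‖mfderiv (𝓡 (E.modelDim i)) (𝓡 (E.dim y)) (E.triv i y hy).symm η w‖) :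
      LipschitzWith 2 (fun ξ => (E.triv i y₀ hy₀).symm (E.triv i y hy ξ)) := by
    set σ : E.Fib y → E.Fib y₀ := fun ξ => (E.triv i y₀ hy₀).symm (E.triv i y hy ξ)
    have hσ : ContMDiff (𝓡 (E.dim y)) (𝓡 (E.dim y₀)) 1 σ :=
      ((E.triv i y₀ hy₀).symm.contMDiff.comp (E.triv i y hy).contMDiff).of_le (by simp)
    refine lipschitzWith_of_norm_mfderiv_le hσ fun x v => ?_
    obtain ⟨η, hη⟩ : ∃ η, (E.triv i y hy).symm η = x := ⟨E.triv i y hy x, by simp⟩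
    subst hη
    obtain ⟨w, hw⟩ :=
      ((E.triv i y hy).symm.mfderivToContinuousLinearEquiv (by simp) η).surjective v
    have hw' : mfderiv (𝓡 (E.modelDim i)) (𝓡 (E.dim y)) (E.triv i y hy).symm η w = v := hw
    have hcomp : σ ∘ (E.triv i y hy).symm = (E.triv i y₀ hy₀).symm := by
      funext z
      simp [σ]
    have h1 : mfderiv (𝓡 (E.modelDim i)) (𝓡 (E.dim y₀)) (σ ∘ (E.triv i y hy).symm) η
        = (mfderiv (𝓡 (E.dim y)) (𝓡 (E.dim y₀)) σ ((E.triv i y hy).symm η)).comp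
          (mfderiv (𝓡 (E.modelDim i)) (𝓡 (E.dim y)) (E.triv i y hy).symm η) :=
      mfderiv_comp η (hσ.mdifferentiable one_ne_zero _)
        ((E.triv i y hy).symm.contMDiff.mdifferentiable (by simp) _)
    have h2 : ‖mfderiv (𝓡 (E.modelDim i)) (𝓡 (E.dim y₀)) (σ ∘ (E.triv i y hy).symm) η w‖
        = ‖mfderiv (𝓡 (E.modelDim i)) (𝓡 (E.dim y₀)) (E.triv i y₀ hy₀).symm η w‖ :=
      congrArg (fun f : E.Model i → E.Fib y₀ =>
        ‖mfderiv (𝓡 (E.modelDim i)) (𝓡 (E.dim y₀)) f η w‖) hcomp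
    rw [h1, ContinuousLinearMap.comp_apply, hw'] at h2
    rw [h2, ← hw']
    exact h η w
  exact ⟨key hy hy₀ fun η w => (hle η w).2, key hy₀ hy fun η w => (hle η w).1⟩

end RiemannianFiberBundle

/-! ### Fine measurable labels of the total space -/

/-- A measurable partition of a compact metric space into sets of radius `δ` whose centers are
`δ`-separated: `lab x` is the number of the cell of `x`, and `p x` its center. -/
theorem exists_net_label {M : Type*} [MetricSpace M] [CompactSpace M] [MeasurableSpace M]
    [BorelSpace M] {δ : ℝ} (hδ : 0 < δ) {N : ℕ}
    (hN : ∀ T : Finset M, IsSeparatedFinset T δ → T.card ≤ N) :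
    ∃ (lab : M → ℕ) (p : M → M), Measurable lab ∧ (∀ x, lab x ≤ N) ∧ (∀ x, dist x (p x) < δ) ∧
      (∀ x x', lab x = lab x' → p x = p x') ∧
      ∀ x x', lab x ≠ lab x' → p x ≠ p x' ∧ δ ≤ dist (p x) (p x') := by
  classical
  obtain ⟨S, hS, hdense⟩ := exists_isSeparatedFinset_dense (M := M) hδ
  let e := S.equivFin
  have hex (x : M) : ∃ k : ℕ, ∃ h : k < S.card, dist x (e.symm ⟨k, h⟩) < δ := by
    obtain ⟨s, hs, hxs⟩ := hdense x
    exact ⟨e ⟨s, hs⟩, (e ⟨s, hs⟩).2, by simpa using hxs⟩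
  have hlt (x : M) : Nat.find (hex x) < S.card := (Nat.find_spec (hex x)).1
  refine ⟨fun x => Nat.find (hex x), fun x => e.symm ⟨Nat.find (hex x), hlt x⟩,
    measurable_find hex fun k => ?_, fun x => (hlt x).le.trans (hN S hS),
    fun x => (Nat.find_spec (hex x)).2, fun x x' h => ?_, fun x x' h => ?_⟩
  · by_cases hk : k < S.card
    · simpa [hk] using (isOpen_lt (continuous_id.dist continuous_const) continuous_const
        : IsOpen {x : M | dist x (e.symm ⟨k, hk⟩) < δ}).measurableSet
    · simp [hk]
  · have : (⟨Nat.find (hex x), hlt x⟩ : Fin S.card) = ⟨Nat.find (hex x'), hlt x'⟩ := Fin.ext h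
    exact congrArg (fun k => (e.symm k : M)) this
  · have hne : (e.symm ⟨Nat.find (hex x), hlt x⟩ : M) ≠ e.symm ⟨Nat.find (hex x'), hlt x'⟩ := by
      intro h0
      have h1 := e.symm.injective (Subtype.ext h0)
      exact h (Fin.mk.inj_iff.1 h1)
    exact ⟨hne, hS _ (Subtype.prop _) _ (Subtype.prop _) hne⟩

namespace RiemannianFiberBundle

variable {B : Type u} [MeasurableSpace B] {E : RiemannianFiberBundle.{u, v} B}

/-- A function on the total space is measurable if in the trivializations it depends only on a
countable class of the base point and, for each class, measurably on the point of the model. -/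
theorem measurable_of_classes {β : Type*} [MeasurableSpace β] {cls : B → ℕ} (hcls : Measurable cls)
    {Λ : ℕ → ∀ i, E.Model i → β} (hΛ : ∀ k i, Measurable (Λ k i)) :
    Measurable fun p : E.Total =>
      Λ (cls p.base) (E.idx p.base) (E.triv (E.idx p.base) p.base rfl p.pt) := by
  have h1 (k : ℕ) : Measurable fun z : Σ i, E.Model i => Λ k z.1 z.2 := fun s hs =>
    MeasurableSpace.measurableSet_iInf.2 fun i => hΛ k i hs
  have h2 : Measurable fun z : ℕ × Σ i, E.Model i => Λ z.1 z.2.1 z.2.2 :=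
    measurable_from_prod_countable_right h1
  exact h2.comp ((hcls.comp measurable_base).prodMk
    (measurable_snd.comp (comap_measurable Total.trivMap)))

/-- Labels of the total space of the bundle such that the points of a fiber with a given label are
close to each other, and such that balls in the fibers meet few labels. -/
theorem exists_labeling [Nonempty B] (R : E.ReferenceCharts) {d : ℕ} (hd : ∀ y, E.dim y ≤ d) {D : ℝ}
    (hD : ∀ y, Metric.diam (Set.univ : Set (E.Fib y)) ≤ D) {δ : ℝ} (hδ : 0 < δ) :
    ∃ (N : ℕ) (l : E.Total → Fin N), Measurable l ∧
      (∀ y (ξ ξ' : E.Fib y), l ⟨y, ξ⟩ = l ⟨y, ξ'⟩ → dist ξ ξ' ≤ 4 * δ) ∧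
      (∀ y (ξ : E.Fib y) (s : ℝ), 0 ≤ s → R.distortion * (2 * s + δ) < R.r →
        ∀ T : Finset (Fin N), (∀ a ∈ T, ∃ ξ' : E.Fib y, dist ξ ξ' ≤ s ∧ l ⟨y, ξ'⟩ = a) →
        (T.card : ℝ) ≤ (1 + 2 * (R.distortion : ℝ) ^ 2 * ((2 * s + δ) / δ)) ^ d) := by
  classical
  obtain ⟨N, hN⟩ := R.exists_card_le hd hD hδ
  obtain ⟨cls, rep, hcls, hclose⟩ := E.exists_measurable_metricClose
  choose lab p hlab hlabN hlabp hsame hdiff using fun y => exists_net_label hδ (hN y)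
  let Λ : ℕ → ∀ i, E.Model i → Fin (N + 1) := fun k i z =>
    if h : E.idx (rep k) = i then
      ⟨lab (rep k) ((E.triv i (rep k) h).symm z), Nat.lt_succ_of_le (hlabN _ _)⟩ else 0
  have hΛ (k i) : Measurable (Λ k i) := by
    by_cases h : E.idx (rep k) = i
    · have h1 : Measurable fun z => lab (rep k) ((E.triv i (rep k) h).symm z) :=
        (hlab _).comp (E.triv i (rep k) h).symm.continuous.measurable
      simp only [Λ, h, dif_pos]
      refine measurable_to_countable' fun a => ?_
      convert h1 (measurableSet_singleton (a : ℕ)) using 1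
      ext z
      simp [Fin.ext_iff]
    · simp only [Λ, h, dif_neg, not_false_eq_true]
      exact measurable_const
  -- the fiber is compared with the reference fiber of its class
  have hσ (y : B) : ∃ σ : E.Fib y → E.Fib (rep (cls y)),
      (∀ ξ ξ', dist (σ ξ) (σ ξ') ≤ 2 * dist ξ ξ') ∧
      (∀ ξ ξ', dist ξ ξ' ≤ 2 * dist (σ ξ) (σ ξ')) ∧
      ∀ ξ, (Λ (cls y) (E.idx y) (E.triv (E.idx y) y rfl ξ) : ℕ) = lab (rep (cls y)) (σ ξ) := by
    have h0 : E.idx (rep (cls y)) = E.idx y := by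
      obtain ⟨i, h, h0, -⟩ := hclose y
      rw [h, h0]
    obtain ⟨h1, h2⟩ := (hclose y).lipschitzWith rfl h0
    refine ⟨_, fun ξ ξ' => h1.dist_le_mul ξ ξ', fun ξ ξ' => ?_, fun ξ => ?_⟩
    · have := h2.dist_le_mul ((E.triv _ _ h0).symm (E.triv _ y rfl ξ))
        ((E.triv _ _ h0).symm (E.triv _ y rfl ξ'))
      simpa using this
    · simp only [Λ, h0, dif_pos]
  choose σ hσ1 hσ2 hσ3 using hσ
  refine ⟨N + 1, _, measurable_of_classes hcls hΛ, fun y ξ ξ' h => ?_, fun y ξ s hs hsr T hT => ?_⟩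
  · have h1 : lab _ (σ y ξ) = lab _ (σ y ξ') := by
      rw [← hσ3, ← hσ3]
      exact congrArg Fin.val h
    have h2 := hlabp _ (σ y ξ)
    have h3 := hlabp _ (σ y ξ')
    rw [hsame _ _ _ h1] at h2
    have h4 := dist_triangle_right (σ y ξ) (σ y ξ') (p _ (σ y ξ'))
    linarith [hσ2 y ξ ξ']
  · have hT' (a : T) : ∃ ξ' : E.Fib y, dist ξ ξ' ≤ s ∧ lab _ (σ y ξ') = (a : ℕ) := by
      obtain ⟨ξ', h1, h2⟩ := hT a a.2
      exact ⟨ξ', h1, by rw [← hσ3]; exact congrArg Fin.val h2⟩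
    choose η hη1 hη2 using hT'
    have hne {a b : T} (h : a ≠ b) : lab _ (σ y (η a)) ≠ lab _ (σ y (η b)) := by
      rw [hη2, hη2]
      exact fun h0 => h (Subtype.ext (Fin.ext h0))
    have hinj : Function.Injective fun a : T => p _ (σ y (η a)) := fun a b hab => by
      by_contra h
      exact (hdiff _ _ _ (hne h)).1 hab
    have hcard : (Finset.univ.image fun a : T => p _ (σ y (η a))).card = T.card := by
      rw [Finset.card_image_of_injective _ hinj]
      simp
    rw [← hcard]
    refine R.card_le hd (ξ := σ y ξ) hδ (by positivity) hsr (fun x hx => ?_) fun x hx x' hx' h => ?_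
    · obtain ⟨a, -, rfl⟩ := Finset.mem_image.1 hx
      have h1 := dist_triangle (σ y ξ) (σ y (η a)) (p _ (σ y (η a)))
      linarith [hσ1 y ξ (η a), hη1 a, hlabp _ (σ y (η a))]
    · obtain ⟨a, -, rfl⟩ := Finset.mem_image.1 hx
      obtain ⟨b, -, rfl⟩ := Finset.mem_image.1 hx'
      exact (hdiff _ _ _ (hne fun h0 => h (by rw [h0]))).2

end RiemannianFiberBundle

/-! ### Labels compatible with the label of an iterate -/

theorem Real.log_natCast_le_of_le_pow {W d : ℕ} {κ a b : ℝ} (hκ : 1 ≤ κ) (hb : 1 ≤ b) (ha : 0 ≤ a)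
    (hW : (W : ℝ) ≤ a ^ d) (hab : a ≤ κ * b) :
    Real.log W ≤ d * (Real.log κ + Real.log b) := by
  have hκb : 1 ≤ κ * b := one_le_mul_of_one_le_of_one_le hκ hb
  rw [← Real.log_mul (by positivity) (by positivity)]
  rcases Nat.eq_zero_or_pos W with rfl | hpos
  · simpa using mul_nonneg (Nat.cast_nonneg d) (Real.log_nonneg hκb)
  · rw [← Real.log_pow]
    exact Real.log_le_log (by exact_mod_cast hpos) (hW.trans (pow_le_pow_left₀ ha hab d))

namespace RiemannianFiberBundle

variable {B : Type u} [MeasurableSpace B] {E : RiemannianFiberBundle.{u, v} B}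

/-- The exponential of the part of the bound for the number of compatible labels, per dimension,
which does not depend on the time. The ball of radius `4 L δ` meets at most
`(1 + 2 c ^ 2 (8 L + 1)) ^ d` labels, with `c` the distortion of the reference charts, and `L` is at
most `c ^ 2 (c ^ 2 + 1)` times `max A 1`, with `A` the norm of the inverse derivative. -/
noncomputable def ReferenceCharts.labelConst (R : E.ReferenceCharts) : ℝ :=
  1 + 2 * (R.distortion : ℝ) ^ 2 *
    (8 * ((R.distortion : ℝ) ^ 2 * ((R.distortion : ℝ) ^ 2 + 1)) + 1)

theorem ReferenceCharts.one_le_labelConst (R : E.ReferenceCharts) : 1 ≤ R.labelConst := by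
  unfold labelConst
  exact le_add_of_nonneg_right (by positivity)

namespace DiffeoBundle

variable {g : B → B} {F : E.DiffeoBundle g}

theorem norm_mfderiv_iter_symm_le (n : ℕ) (y : B) (ξ : E.Fib y)
    (w : TangentSpace (𝓡 (E.dim (g^[n] y))) (F.iter n y ξ)) :
    ‖mfderiv (𝓡 (E.dim (g^[n] y))) (𝓡 (E.dim y)) (F.iter n y).symm (F.iter n y ξ) w‖
      ≤ F.invDerivNorm n ⟨y, ξ⟩ * ‖w‖ := by
  -- the point `(F.iter n y).symm (F.iter n y ξ)` is only propositionally equal to `ξ`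
  have key (x : E.Fib y) (hx : x = ξ) (v : EuclideanSpace ℝ (Fin (E.dim y))) :
      ‖(show TangentSpace (𝓡 (E.dim y)) x from v)‖
        = ‖(show TangentSpace (𝓡 (E.dim y)) ξ from v)‖ := by
    subst hx
    rfl
  have hid (h : E.Fib y → E.Fib y) (hh : h = id) (v : EuclideanSpace ℝ (Fin (E.dim y))) :
      (mfderiv (𝓡 (E.dim y)) (𝓡 (E.dim y)) h ξ v : EuclideanSpace ℝ (Fin (E.dim y))) = v := by
    subst hh
    rw [mfderiv_id]
    rfl
  have hcomp : mfderiv (𝓡 (E.dim y)) (𝓡 (E.dim y)) ((F.iter n y).symm ∘ F.iter n y) ξ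
      = (mfderiv (𝓡 (E.dim (g^[n] y))) (𝓡 (E.dim y)) (F.iter n y).symm (F.iter n y ξ)).comp
        (mfderiv (𝓡 (E.dim y)) (𝓡 (E.dim (g^[n] y))) (F.iter n y) ξ) :=
    mfderiv_comp ξ ((F.iter n y).symm.contMDiff.mdifferentiable (by norm_num) _)
      ((F.iter n y).contMDiff.mdifferentiable (by norm_num) _)
  obtain ⟨v, rfl⟩ := (F.deriv n y ξ).surjective w
  have h0 : mfderiv (𝓡 (E.dim (g^[n] y))) (𝓡 (E.dim y)) (F.iter n y).symm (F.iter n y ξ)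
      (F.deriv n y ξ v) = (show EuclideanSpace ℝ (Fin (E.dim y)) from v) :=
    (DFunLike.congr_fun hcomp v).symm.trans
      (hid _ (funext fun x => (F.iter n y).symm_apply_apply x) v)
  have h1 : ‖mfderiv (𝓡 (E.dim (g^[n] y))) (𝓡 (E.dim y)) (F.iter n y).symm (F.iter n y ξ)
      (F.deriv n y ξ v)‖ = ‖(F.deriv n y ξ).symm (F.deriv n y ξ v)‖ := by
    rw [ContinuousLinearEquiv.symm_apply_apply, h0]
    exact key _ ((F.iter n y).symm_apply_apply ξ) v
  rw [h1]
  exact ((F.deriv n y ξ).symm : TangentSpace (𝓡 (E.dim (g^[n] y))) (F.iter n y ξ) →L[ℝ]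
    TangentSpace (𝓡 (E.dim y)) ξ).le_opNorm _

theorem invDerivNorm_nonneg (n : ℕ) (p : E.Total) : 0 ≤ F.invDerivNorm n p := by
  exact norm_nonneg ((F.deriv n p.base p.pt).symm : TangentSpace (𝓡 (E.dim (g^[n] p.base)))
    (F.iter n p.base p.pt) →L[ℝ] TangentSpace (𝓡 (E.dim p.base)) p.pt)

theorem lipschitzWith_iter_symm {c : ℝ≥0} (hc : ∀ p, F.invDerivNorm 1 p ≤ c) (n : ℕ) (y : B) :
    LipschitzWith (c ^ n) (F.iter n y).symm := by
  have h1 (y : B) : LipschitzWith c (F.map y).symm := by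
    refine lipschitzWith_of_norm_mfderiv_le (I := 𝓡 (E.dim (g y))) (I' := 𝓡 (E.dim y))
      ((F.map y).symm.contMDiff.of_le (by norm_num)) fun η w => ?_
    obtain ⟨ξ, rfl⟩ := (F.map y).surjective η
    exact (norm_mfderiv_iter_symm_le (F := F) 1 y ξ w).trans
      (mul_le_mul_of_nonneg_right (hc _) (norm_nonneg _))
  induction n generalizing y with
  | zero => rw [pow_zero]; exact LipschitzWith.id
  | succ n ih => rw [pow_succ']; exact (h1 y).comp (ih (g y))

/-- Points whose `n`-th iterates are close to the `n`-th iterate of `ξ` are close to `ξ`, by a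
factor which is controlled by the derivative of the inverse of `F^(n)` at this single point. -/
theorem exists_forall_dist_le (R : E.ReferenceCharts) (n : ℕ) (y : B) (ξ : E.Fib y) :
    ∃ ρ > 0, ∀ ξ' : E.Fib y, dist (F.iter n y ξ) (F.iter n y ξ') < ρ →
      dist ξ ξ' ≤ R.distortion ^ 2 * (R.distortion ^ 2 * F.invDerivNorm n ⟨y, ξ⟩ + 1)
        * dist (F.iter n y ξ) (F.iter n y ξ') := by
  have h := IsNormalChart.eventually_dist_le R.r_pos
    (R.isNormalChart y ((F.iter n y).symm (F.iter n y ξ)))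
    (R.isNormalChart (g^[n] y) (F.iter n y ξ))
    ((F.iter n y).symm.contMDiff.mdifferentiable (by norm_num) _)
    (invDerivNorm_nonneg n ⟨y, ξ⟩) (norm_mfderiv_iter_symm_le n y ξ)
  obtain ⟨ρ, hρ, hball⟩ := Metric.eventually_nhds_iff.1 h
  refine ⟨ρ, hρ, fun ξ' hξ' => ?_⟩
  have := hball (y := F.iter n y ξ') (by rwa [dist_comm])
  simpa using this

/-- The number of compatible labels is controlled by any Lipschitz constant `L` at `ξ` of the
inverse of the `n`-th iterate: the compatible labels meet the ball of radius `4 L δ` around `ξ`. -/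
theorem labelCount_le (R : E.ReferenceCharts) {d N : ℕ} {δ : ℝ} (hδ : 0 < δ) {l : E.Total → Fin N}
    (hfine : ∀ y (ξ ξ' : E.Fib y), l ⟨y, ξ⟩ = l ⟨y, ξ'⟩ → dist ξ ξ' ≤ 4 * δ)
    (hcount : ∀ y (ξ : E.Fib y) (s : ℝ), 0 ≤ s → R.distortion * (2 * s + δ) < R.r →
        ∀ T : Finset (Fin N), (∀ a ∈ T, ∃ ξ' : E.Fib y, dist ξ ξ' ≤ s ∧ l ⟨y, ξ'⟩ = a) →
        (T.card : ℝ) ≤ (1 + 2 * (R.distortion : ℝ) ^ 2 * ((2 * s + δ) / δ)) ^ d)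
    (K : ∀ y, Measure (E.Fib y)) {n : ℕ} {p : E.Total} {L : ℝ} (hL : 0 ≤ L)
    (hLr : R.distortion * ((8 * L + 1) * δ) < R.r)
    (hdist : ∀ ξ', dist (F.iter n p.base p.pt) (F.iter n p.base ξ') ≤ 4 * δ →
      dist p.pt ξ' ≤ L * dist (F.iter n p.base p.pt) (F.iter n p.base ξ')) :
    (F.labelCount K l n p : ℝ) ≤ (1 + 2 * (R.distortion : ℝ) ^ 2 * (8 * L + 1)) ^ d := by
  obtain ⟨y, ξ⟩ := p
  have h1 : 2 * (L * (4 * δ)) + δ = (8 * L + 1) * δ := by ring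
  have h2 : (2 * (L * (4 * δ)) + δ) / δ = 8 * L + 1 := by rw [h1, mul_div_cancel_right₀ _ hδ.ne']
  rw [← h2]
  refine hcount y ξ (L * (4 * δ)) (by positivity) (by rwa [h1]) _ fun a ha => ?_
  obtain ⟨ξ', hξ'1, hξ'2⟩ := nonempty_of_measure_ne_zero (Finset.mem_filter.1 ha).2
  refine ⟨ξ', ?_, hξ'1⟩
  rw [total_iterate, total_iterate] at hξ'2
  have h3 := hfine _ _ _ hξ'2.symm
  exact (hdist ξ' h3).trans (mul_le_mul_of_nonneg_left h3 hL)

/-- The fiber entropy of `n` steps is bounded by the mean of a function which is at most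
`d log⁺ ‖(D F^(n))⁻¹‖`, up to a constant which does not depend on `n`. -/
theorem exists_mul_fiberEntropy_le_lintegral [Nonempty B] (R : E.ReferenceCharts) {d : ℕ}
    (hd : ∀ y, E.dim y ≤ d) {D : ℝ} (hD : ∀ y, Metric.diam (Set.univ : Set (E.Fib y)) ≤ D)
    {c : ℝ≥0} (hc1 : 1 ≤ c) (hc : ∀ p, F.invDerivNorm 1 p ≤ c)
    {M : Measure E.Total} [IsProbabilityMeasure M] {m : Measure B} [IsProbabilityMeasure m]
    {K : ∀ y, Measure (E.Fib y)} (hK : E.IsDisintegration M m K)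
    (hM : MeasurePreserving F.total M M) (hm : MeasurePreserving g m m) (n : ℕ) :
    ∃ V : E.Total → ℝ≥0∞, Measurable V ∧ n * F.fiberEntropy m K ≤ ∫⁻ p, V p ∂M ∧
      (∀ p, V p ≤ ENNReal.ofReal (d * (Real.log R.labelConst + n * Real.log c))) ∧
      ∀ p, V p ≤ ENNReal.ofReal
        (d * (Real.log R.labelConst + Real.log (max (F.invDerivNorm n p) 1))) := by
  have hx1 : (1 : ℝ) ≤ R.distortion := by exact_mod_cast R.one_le_distortion
  have hc1' : (1 : ℝ) ≤ c := by exact_mod_cast hc1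
  have hcn : (1 : ℝ) ≤ (c : ℝ) ^ n := one_le_pow₀ hc1'
  set x : ℝ := (R.distortion : ℝ) with hx
  have hx0 : 0 < x := by positivity
  have hx2 : 1 ≤ x ^ 2 := one_le_pow₀ hx1
  have hconst : R.labelConst = 1 + 2 * x ^ 2 * (8 * (x ^ 2 * (x ^ 2 + 1)) + 1) := rfl
  -- the scale is so small that the uniform estimate applies at all smaller scales
  obtain ⟨δ₀, hδ₀, hδ₀r⟩ : ∃ δ₀ > 0, x * ((8 * (c : ℝ) ^ n + 1) * δ₀) < R.r := by
    refine ⟨R.r / (2 * (x * (8 * (c : ℝ) ^ n + 1))), div_pos R.r_pos (by positivity), ?_⟩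
    have : x * ((8 * (c : ℝ) ^ n + 1) * (R.r / (2 * (x * (8 * (c : ℝ) ^ n + 1))))) = R.r / 2 := by
      field_simp
    linarith [R.r_pos]
  let δ : ℕ → ℝ := fun k => δ₀ / (k + 1)
  have hδ (k) : 0 < δ k := div_pos hδ₀ (by positivity)
  have hδle (k) : δ k ≤ δ₀ := div_le_self hδ₀.le (by linarith [(Nat.cast_nonneg k : (0 : ℝ) ≤ k)])
  have hδlim : Tendsto δ atTop (𝓝 0) := by
    have := (tendsto_one_div_add_atTop_nhds_zero_nat (𝕜 := ℝ)).const_mul δ₀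
    simpa [δ, div_eq_mul_inv] using this
  choose N l hl hfine hcount using fun k => exists_labeling R hd hD (hδ k)
  let f : ℕ → E.Total → ℝ≥0∞ := fun k p =>
    ENNReal.ofReal (Real.log (F.labelCount K (l k) n p))
  have hf (k) : Measurable (f k) := by
    have h1 : Measurable fun W : ℕ => ENNReal.ofReal (Real.log W) := measurable_from_top
    exact h1.comp (measurable_labelCount hK (hl k) n)
  -- the inverse of the `n`-th iterate is `c ^ n`-Lipschitz
  have hunif (k p) : f k p
      ≤ ENNReal.ofReal (d * (Real.log R.labelConst + n * Real.log c)) := by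
    refine ENNReal.ofReal_le_ofReal ?_
    rw [← Real.log_pow]
    refine Real.log_natCast_le_of_le_pow R.one_le_labelConst hcn ?_
      (labelCount_le R (hδ k) (hfine k) (hcount k) K (zero_le_one.trans hcn)
        (lt_of_le_of_lt ?_ hδ₀r) fun ξ' _ => ?_) ?_
    · positivity
    · have := hδle k
      gcongr
    · have := (lipschitzWith_iter_symm hc n p.base).dist_le_mul (F.iter n p.base p.pt)
        (F.iter n p.base ξ')
      simpa using this
    · rw [hconst]
      nlinarith [mul_nonneg (zero_le_one.trans hx2) (zero_le_one.trans hcn),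
        mul_le_mul hx2 hx2 zero_le_one (zero_le_one.trans hx2),
        mul_nonneg (mul_nonneg (sq_nonneg x) (sub_nonneg.2 hx2)) (zero_le_one.trans hcn)]
  -- at a single point, only the derivative at this point matters for small labels
  have hloc (p) : ∀ᶠ k in atTop, f k p ≤ ENNReal.ofReal
      (d * (Real.log R.labelConst + Real.log (max (F.invDerivNorm n p) 1))) := by
    obtain ⟨ρ, hρ, hdist⟩ := exists_forall_dist_le (F := F) R n p.base p.pt
    set A := F.invDerivNorm n p with hA
    have hA0 : 0 ≤ A := invDerivNorm_nonneg n p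
    set L : ℝ := x ^ 2 * (x ^ 2 * A + 1) with hL
    have hsmall : ∀ᶠ k in atTop, 4 * δ k < ρ := by
      have := hδlim.const_mul 4
      rw [mul_zero] at this
      exact this.eventually_lt_const hρ
    have hsmall' : ∀ᶠ k in atTop, x * ((8 * L + 1) * δ k) < R.r := by
      have := (hδlim.const_mul (8 * L + 1)).const_mul x
      rw [mul_zero, mul_zero] at this
      exact this.eventually_lt_const R.r_pos
    filter_upwards [hsmall, hsmall'] with k hk hk'
    refine ENNReal.ofReal_le_ofReal ?_
    refine Real.log_natCast_le_of_le_pow R.one_le_labelConst (le_max_right A 1) ?_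
      (labelCount_le R (hδ k) (hfine k) (hcount k) K (L := L) (by positivity) hk'
        fun ξ' h => hdist ξ' (h.trans_lt hk)) ?_
    · positivity
    · rw [hconst, hL]
      have h1 : A ≤ max A 1 := le_max_left A 1
      have h2 : 1 ≤ max A 1 := le_max_right A 1
      calc 1 + 2 * x ^ 2 * (8 * (x ^ 2 * (x ^ 2 * A + 1)) + 1)
          ≤ max A 1 + 2 * x ^ 2 * (8 * (x ^ 2 * (x ^ 2 * max A 1 + max A 1)) + max A 1) := by
            gcongr
        _ = _ := by ring
  refine ⟨fun p => limsup (fun k => f k p) atTop, Measurable.limsup hf, ?_, fun p => ?_,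
    fun p => ?_⟩
  · refine (mul_fiberEntropy_le_liminf hK hM hm N l hl (fun ε hε => ?_) n).trans
      ((liminf_le_limsup (by isBoundedDefault) (by isBoundedDefault)).trans
      (limsup_lintegral_le (fun _ =>
        ENNReal.ofReal (d * (Real.log R.labelConst + n * Real.log c))) hf
        (fun k => Eventually.of_forall (hunif k)) ?_))
    · have := hδlim.const_mul 4
      rw [mul_zero] at this
      filter_upwards [this.eventually_lt_const hε] with k hk y ξ ξ' h
      exact (hfine k y ξ ξ' h).trans hk.le
    · rw [lintegral_const, measure_univ, mul_one]
      exact ENNReal.ofReal_ne_top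
  · exact limsup_le_of_le (by isBoundedDefault) (Eventually.of_forall fun k => hunif k p)
  · exact limsup_le_of_le (by isBoundedDefault) (hloc p)

end DiffeoBundle

end RiemannianFiberBundle

/-! ### The limit of large times -/

theorem RiemannianFiberBundle.measurable_toTotal {X : Type*} [MeasurableSpace X] {Y : Type*}
    [MeasurableSpace Y] (E : RiemannianFiberBundle Y) (q : X → Y) :
    Measurable (RiemannianFiberBundle.Pullback.toTotal : E.Pullback q → E.Total) :=
  measurable_snd.comp measurable_subtype_coe

/-- If `-log (A n) / n` tends to `γ`, then the upper bounds for the fiber entropy per unit of time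
tend to `-d min(γ, 0)`. -/
theorem tendsto_mul_add_log_max_div {A : ℕ → ℝ} (hA : ∀ n, 0 ≤ A n) {γ : ℝ}
    (hγ : Tendsto (fun n : ℕ => -((1 / (n : ℝ)) * Real.log (A n))) atTop (𝓝 γ)) (d : ℕ) (b : ℝ) :
    Tendsto (fun n : ℕ => d * (b + Real.log (max (A (n + 1)) 1)) / ((n + 1 : ℕ) : ℝ)) atTop
      (𝓝 (-(d : ℝ) * min γ 0)) := by
  have hlog (n : ℕ) : Real.log (max (A n) 1) = max (Real.log (A n)) 0 := by
    rcases le_total (A n) 1 with h | h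
    · rw [max_eq_right h, Real.log_one, max_eq_right (Real.log_nonpos (hA n) h)]
    · rw [max_eq_left h, max_eq_left (Real.log_nonneg h)]
  have h1 : Tendsto (fun n : ℕ => b / (n : ℝ)) atTop (𝓝 0) :=
    tendsto_const_div_atTop_nhds_zero_nat b
  have h2 := (h1.add (hγ.neg.max (tendsto_const_nhds (x := (0 : ℝ))))).const_mul (d : ℝ)
  have h3 : (d : ℝ) * (0 + max (-γ) 0) = -(d : ℝ) * min γ 0 := by
    rw [zero_add, neg_mul, ← mul_neg, ← max_neg_neg, neg_zero]
  rw [h3] at h2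
  refine ((tendsto_add_atTop_iff_nat 1).2 h2).congr fun n => ?_
  have hn : (0 : ℝ) < ((n + 1 : ℕ) : ℝ) := by positivity
  rw [hlog, neg_neg, mul_div_assoc, add_div]
  congr 2
  rw [← max_div_div_right hn.le, zero_div, one_div_mul_eq_div]

theorem mainTheorem2 {X : Type*} [MeasurableSpace X] {Y : Type*} [MeasurableSpace Y]
    (m : Measure X) [IsProbabilityMeasure m] (f : X ≃ᵐ X) (hf : Ergodic f m)
    (q : X → Y) (hq : Measurable q) (g : Y → Y) (hg : Measurable g)
    (hfg : ∀ x, q (f x) = g (q x))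
    (E : RiemannianFiberBundle Y) (d : ℕ) (hd : IsGreatest (Set.range E.dim) d)
    (D : ℝ) (hD : ∀ y, Metric.diam (Set.univ : Set (E.Fib y)) ≤ D)
    (R : E.ReferenceCharts) (F : E.DiffeoBundle g) (C : ℝ) (hF : F.IsBounded R C)
    (M : Measure (E.Pullback q)) [IsProbabilityMeasure M]
    (hM : Ergodic (F.pullback hfg) M) (hMm : M.map RiemannianFiberBundle.Pullback.proj = m)
    (γ : ℝ) (hγ : ∀ᵐ p ∂M, Tendsto
      (fun n : ℕ => -((1 / (n : ℝ)) * Real.log (F.invDerivNorm n p.toTotal))) atTop (𝓝 γ))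
    (K : ∀ y, Measure (E.Fib y))
    (hK : E.IsDisintegration (M.map RiemannianFiberBundle.Pullback.toTotal) (m.map q) K) :
    F.fiberEntropy (m.map q) K ≤ ENNReal.ofReal (-(d : ℝ) * min γ 0) := by
  have hT := RiemannianFiberBundle.measurable_toTotal E q
  have hprob : IsProbabilityMeasure (M.map RiemannianFiberBundle.Pullback.toTotal) :=
    Measure.isProbabilityMeasure_map hT.aemeasurable
  have hprob' : IsProbabilityMeasure (m.map q) := Measure.isProbabilityMeasure_map hq.aemeasurable
  have : Nonempty Y := (m.map q).nonempty_of_neZero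
  have hM' : MeasurePreserving F.total (M.map RiemannianFiberBundle.Pullback.toTotal)
      (M.map RiemannianFiberBundle.Pullback.toTotal) := by
    refine ⟨F.measurable_total, ?_⟩
    rw [Measure.map_map F.measurable_total hT]
    have : F.total ∘ RiemannianFiberBundle.Pullback.toTotal
        = RiemannianFiberBundle.Pullback.toTotal ∘ F.pullback hfg := rfl
    rw [this, ← Measure.map_map hT hM.measurable, hM.map_eq]
  have hm' : MeasurePreserving g (m.map q) (m.map q) := by
    refine ⟨hg, ?_⟩
    have : g ∘ q = q ∘ f := funext fun x => (hfg x).symm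
    rw [Measure.map_map hg hq, this, ← Measure.map_map hq f.measurable, hf.map_eq]
  set c : ℝ≥0 := max C.toNNReal 1
  have hc (p) : F.invDerivNorm 1 p ≤ c :=
    ((hF.1 p).2.trans (Real.le_coe_toNNReal C)).trans (NNReal.coe_le_coe.2 (le_max_left _ _))
  set b := Real.log (R.labelConst)
  have hb : 0 ≤ b := Real.log_nonneg R.one_le_labelConst
  choose V hVm hVκ hVc hVA using fun n =>
    RiemannianFiberBundle.DiffeoBundle.exists_mul_fiberEntropy_le_lintegral R
      (fun y => hd.2 ⟨y, rfl⟩) hD (le_max_right _ _) hc hK hM' hm' n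
  -- the index is shifted to avoid the time `0`
  let U : ℕ → E.Pullback q → ℝ≥0∞ := fun n p => V (n + 1) p.toTotal / ((n + 1 : ℕ) : ℝ≥0∞)
  have hUm (n) : Measurable (U n) := ((hVm (n + 1)).comp hT).div_const _
  have hdiv (n : ℕ) (t : ℝ) : ENNReal.ofReal t / ((n + 1 : ℕ) : ℝ≥0∞)
      = ENNReal.ofReal (t / ((n + 1 : ℕ) : ℝ)) := by
    rw [ENNReal.ofReal_div_of_pos (by positivity), ENNReal.ofReal_natCast]
  have hκ (n) : F.fiberEntropy (m.map q) K ≤ ∫⁻ p, U n p ∂M := by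
    have h1 : ∫⁻ p, U n p ∂M
        = (∫⁻ p, V (n + 1) p ∂(M.map RiemannianFiberBundle.Pullback.toTotal))
          / ((n + 1 : ℕ) : ℝ≥0∞) := by
      rw [lintegral_map (hVm _) hT]
      simp only [U, div_eq_mul_inv]
      exact lintegral_mul_const _ ((hVm (n + 1)).comp hT)
    rw [h1, ENNReal.le_div_iff_mul_le (Or.inl (by simp)) (Or.inl (ENNReal.natCast_ne_top _)),
      mul_comm]
    exact hVκ (n + 1)
  have hUc (n p) : U n p ≤ ENNReal.ofReal (d * (b + Real.log c)) := by
    refine (ENNReal.div_le_div_right (hVc (n + 1) p.toTotal) _).trans ?_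
    rw [hdiv]
    refine ENNReal.ofReal_le_ofReal ?_
    have hn : (1 : ℝ) ≤ ((n + 1 : ℕ) : ℝ) := by
      push_cast
      linarith [(Nat.cast_nonneg n : (0 : ℝ) ≤ n)]
    rw [div_le_iff₀ (by positivity), mul_assoc]
    gcongr
    nlinarith
  calc F.fiberEntropy (m.map q) K ≤ limsup (fun n => ∫⁻ p, U n p ∂M) atTop :=
        le_limsup_of_frequently_le (Frequently.of_forall hκ) (by isBoundedDefault)
    _ ≤ ∫⁻ p, limsup (fun n => U n p) atTop ∂M :=
        limsup_lintegral_le (fun _ => ENNReal.ofReal (d * (b + Real.log c))) hUm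
          (fun n => Eventually.of_forall (hUc n)) (by
            rw [lintegral_const, measure_univ, mul_one]
            exact ENNReal.ofReal_ne_top)
    _ ≤ ∫⁻ _, ENNReal.ofReal (-(d : ℝ) * min γ 0) ∂M := by
        refine lintegral_mono_ae ?_
        filter_upwards [hγ] with p hp
        have h1 := ENNReal.tendsto_ofReal (tendsto_mul_add_log_max_div
          (fun n => RiemannianFiberBundle.DiffeoBundle.invDerivNorm_nonneg n p.toTotal) hp d b)
        rw [← h1.limsup_eq]
        refine limsup_le_limsup (Eventually.of_forall fun n => ?_)
        beta_reduce
        rw [← hdiv]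
        exact ENNReal.div_le_div_right (hVA (n + 1) p.toTotal) _
    _ = ENNReal.ofReal (-(d : ℝ) * min γ 0) := by simp
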